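/- Let $c\in\mathbb C\setminus\{0\}$, $g(x,y)=\frac{c}{x-y}$, $f(x,y)=\frac{x-y+c}{x-y}$, $h(x,y)=\frac{x-y+c}{c}$, and let $[1]=[2]=0$, $[3]=1$. Let $\mathcal H$ be a complex vector space, $D\subseteq\mathbb C$ a set of spectral parameters, and let $T_{ij}(u)$ ($1\le i,j\le 3$, $u\in D$) be linear operators on $\mathcal H$ satisfying the $\mathfrak{gl}(2|1)$ relations $$T_{ij}(u)T_{kl}(v)-(-1)^{([i]+[j])([k]+[l])}T_{kl}(v)T_{ij}(u)=(-1)^{[i]([k]+[l])+[k][l]}g(u,v)\bigl(T_{kj}(v)T_{il}(u)-T_{kj}(u)T_{il}(v)\bigr)$$ for all distinct $u,v\in D$. For an ordered set $\bar x=\{x_1,\dots,x_n\}$ put $T_{ij}(\bar x)=T_{ij}(x_1)\cdots T_{ij}(x_n)$ if $[i]+[j]$ is even, and for $j=1,2$ $$\mathbb T_{j3}(\bar x)=\frac{T_{j3}(x_1)\cdots T_{j3}(x_n)}{\prod_{l>m}h(x_l,x_m)},\qquad \mathbb T_{3j}(\bar x)=\frac{T_{3j}(x_1)\cdots T_{3j}(x_n)}{\prod_{l>m}h(x_m,x_l)}.$$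 A scalar function of one or two variables written with sets as arguments denotes the product over all their elements (all pairs). For $\#\bar x=\#\bar y=n$ let $$K(\bar x|\bar y)=\prod_{j<k}g(x_j,x_k)\prod_{j>k}g(y_j,y_k)\;h(\bar x,\bar y)\det_n\Bigl(\frac{g(x_j,y_k)}{h(x_j,y_k)}\Bigr),\qquad K(\emptyset|\emptyset)=1.$$ For $\bar u=\{u_1,\dots,u_a\}$ and $\bar v=\{v_1,\dots,v_b\}$ ($a,b\ge0$) in $D$ define $$X_{a,b}(\bar u,\bar v)=\sum g(\bar v_\alpha,\bar u_\alpha)f(\bar u_\alpha,\bar u_{\bar\alpha})g(\bar v_{\bar\alpha},\bar v_\alpha)h(\bar u_\alpha,\bar u_\alpha)\,\mathbb T_{13}(\bar u_\alpha)T_{12}(\bar u_{\bar\alpha})\mathbb T_{23}(\bar v_{\bar\alpha})T_{22}(\bar v_\alpha),$$ $$Y_{a,b}(\bar u,\bar v)=\sum K(\bar v_\alpha|\bar u_\alpha)f(\bar u_\alpha,\bar u_{\bar\alpha})g(\bar v_{\bar\alpha},\bar v_\alpha)\,\mathbb T_{13}(\bar v_\alpha)\mathbb T_{23}(\bar v_{\bar\alpha})T_{12}(\bar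 u_{\bar\alpha})T_{22}(\bar u_\alpha),$$ the sums being over all partitions $\bar u\Rightarrow\{\bar u_\alpha,\bar u_{\bar\alpha}\}$, $\bar v\Rightarrow\{\bar v_\alpha,\bar v_{\bar\alpha}\}$ with $\#\bar u_\alpha=\#\bar v_\alpha=n$, $n=0,1,\dots,\min(a,b)$, every subset in its natural order; let $X^{(n)}$, $Y^{(n)}$ be the partial sums with $n$ fixed. Assume that no denominator vanishes: the numbers $u_1,\dots,u_a,v_1,\dots,v_b$ are pairwise distinct, and $u_i-u_j+c\ne0$, $v_i-v_j+c\neq0$, $v_j-u_i+c\ne0$ for all $i,j$. Then, for all $a$ and $b$: 1. $X_{a,b}(\bar u,\bar v)=Y_{a,b}(\bar u,\bar v)$; equivalently, $[T_{12}(\bar u),\mathbb T_{23}(\bar v)]=\sum_{n=1}^{\min(a,b)}\bigl(Y^{(n)}-X^{(n)}\bigr)$. 2. Let $\Omega\in\mathcal H$ satisfy $T_{ii}(u)\Omega=\lambda_i(u)\Omega$ and $T_{ij}(u)\Omega=0$ for $i>j$ ($u\in D$). Then the Bethe vector $\Phi_{a,b}(\bar u,\bar v)=X_{a,b}(\bar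 u,\bar v)\Omega$ satisfies $\Phi_{a,b}=Y_{a,b}\Omega$, and $$\Phi_{a,b}=\sum g(\bar v_\alpha,\bar u_\alpha)f(\bar u_\alpha,\bar u_{\bar\alpha})g(\bar v_{\bar\alpha},\bar v_\alpha)h(\bar u_\alpha,\bar u_\alpha)\,\lambda_2(\bar v_\alpha)\,\mathbb T_{13}(\bar u_\alpha)T_{12}(\bar u_{\bar\alpha})\mathbb T_{23}(\bar v_{\bar\alpha})\Omega$$ $$\phantom{\Phi_{a,b}}=\sum K(\bar v_\alpha|\bar u_\alpha)f(\bar u_\alpha,\bar u_{\bar\alpha})g(\bar v_{\bar\alpha},\bar v_\alpha)\,\lambda_2(\bar u_\alpha)\,\mathbb T_{13}(\bar v_\alpha)\mathbb T_{23}(\bar v_{\bar\alpha})T_{12}(\bar u_{\bar\alpha})\Omega .$$ 3. Let $\psi$ be the linear map on noncommutative polynomials in the symbols $T_{ij}(u)$ with $\psi(1)=1$, $\psi(T_{ij}(u))=(-1)^{[i][j]+[i]}T_{ji}(u)$ and $\psi(AB)=(-1)^{[A][B]}\psi(B)\psi(A)$ for monomials $A,B$, the parity of a monomial being the sum of the parities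 $[i]+[j]$ of its letters. Let $\Omega^\dagger\in\mathcal H^*$ satisfy $\Omega^\dagger T_{ii}(u)=\lambda_i(u)\Omega^\dagger$ and $\Omega^\dagger T_{ij}(u)=0$ for $i<j$ ($u\in D$). Then the dual Bethe vector $\Phi^\dagger_{a,b}(\bar u,\bar v)=\Omega^\dagger\,\psi(X_{a,b}(\bar u,\bar v))$ satisfies $$\Phi^\dagger_{a,b}=(-1)^{b(b-1)/2}\sum g(\bar v_\alpha,\bar u_\alpha)f(\bar u_\alpha,\bar u_{\bar\alpha})g(\bar v_{\bar\alpha},\bar v_\alpha)h(\bar u_\alpha,\bar u_\alpha)\,\lambda_2(\bar v_\alpha)\,\Omega^\dagger\,\mathbb T_{32}(\bar v_{\bar\alpha})T_{21}(\bar u_{\bar\alpha})\mathbb T_{31}(\bar u_\alpha)$$ $$\phantom{\Phi^\dagger_{a,b}}=(-1)^{b(b-1)/2}\sum K(\bar v_\alpha|\bar u_\alpha)f(\bar u_\alpha,\bar u_{\bar\alpha})g(\bar v_{\bar\alpha},\bar v_\alpha)\,\lambda_2(\bar u_\alpha)\,\Omega^\dagger\,T_{21}(\bar u_{\bar\alpha})\mathbb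 T_{32}(\bar v_{\bar\alpha})\mathbb T_{31}(\bar v_\alpha).$$ All sums in 2 and 3 are over the same partitions as in the definition of $X_{a,b}$ and $Y_{a,b}$. -/

import Mathlib

open Finset

namespace SuperYangian

noncomputable section

/-! The indices `1, 2, 3` of the monodromy matrix are `0, 1, 2 : Fin 3`. -/

/-- The parity `[1] = [2] = 0`, `[3] = 1`. -/
def par : Fin 3 → ℕ := ![0, 0, 1]

/-- `g(x,y) = c / (x - y)`. -/
def g (c x y : ℂ) : ℂ := c / (x - y)

/-- `f(x,y) = (x - y + c) / (x - y)`. -/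
def f (c x y : ℂ) : ℂ := (x - y + c) / (x - y)

/-- `h(x,y) = (x - y + c) / c`. -/
def h (c x y : ℂ) : ℂ := (x - y + c) / c

/-- The commutation relations of the entries `T i j u` of a `gl(2|1)` monodromy matrix, for all
pairs of distinct spectral parameters in `D`: the graded commutator of `T i j u` and `T k l v` is
`(-1)^([i]([k]+[l])+[k][l]) g(u,v) (T k j v * T i l u - T k j u * T i l v)`. -/
def IsMonodromy {A : Type*} [Ring A] [Algebra ℂ A] (c : ℂ) (D : Set ℂ)
    (T : Fin 3 → Fin 3 → ℂ → A) : Prop :=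
  ∀ i j k l : Fin 3, ∀ u ∈ D, ∀ v ∈ D, u ≠ v →
    T i j u * T k l v
        - ((-1 : ℂ) ^ ((par i + par j) * (par k + par l))) • (T k l v * T i j u)
      = ((-1 : ℂ) ^ (par i * (par k + par l) + par k * par l) * g c u v) •
          (T k j v * T i l u - T k j u * T i l v)

section Products

variable {ι κ : Type*} [LinearOrder ι]

/-- `φ(x̄_s, ȳ_t)`: the product of `φ (x i) (y j)` over `i ∈ s`, `j ∈ t`. -/
def prod₂ {ι κ : Type*} (φ : ℂ → ℂ → ℂ) (x : ι → ℂ) (s : Finset ι) (y : κ → ℂ) (t : Finset κ) :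
    ℂ :=
  ∏ i ∈ s, ∏ j ∈ t, φ (x i) (y j)

/-- The product `F (x i₁) * ⋯ * F (x iₙ)` over `s = {i₁ < ⋯ < iₙ}`, in increasing order. -/
def ordProd {A : Type*} [Ring A] (F : ℂ → A) (x : ι → ℂ) (s : Finset ι) : A :=
  (s.sort.map fun i => F (x i)).prod

/-- `𝕋_{j3}(x̄_s)`: the ordered product of the `T_{j3}(x_i)`, divided by the product of
`h(x_l, x_m)` over `l > m`. -/
def colT {A : Type*} [Ring A] [Algebra ℂ A] (c : ℂ) (T : Fin 3 → Fin 3 → ℂ → A) (j : Fin 3)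
    (x : ι → ℂ) (s : Finset ι) : A :=
  (∏ l ∈ s, ∏ m ∈ s with m < l, h c (x l) (x m))⁻¹ • ordProd (T j 2) x s

/-- `𝕋_{3k}(x̄_s)`: the ordered product of the `T_{3k}(x_i)`, divided by the product of
`h(x_m, x_l)` over `l > m`. -/
def rowT {A : Type*} [Ring A] [Algebra ℂ A] (c : ℂ) (T : Fin 3 → Fin 3 → ℂ → A) (k : Fin 3)
    (x : ι → ℂ) (s : Finset ι) : A :=
  (∏ l ∈ s, ∏ m ∈ s with m < l, h c (x m) (x l))⁻¹ • ordProd (T 2 k) x s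

end Products

/-- The domain wall partition function `K(x̄|ȳ)` in its determinant representation. -/
def dwpf (c : ℂ) {n : ℕ} (x y : Fin n → ℂ) : ℂ :=
  (∏ j, ∏ k with j < k, g c (x j) (x k)) * (∏ j, ∏ k with k < j, g c (y j) (y k)) *
    (∏ j, ∏ k, h c (x j) (y k)) *
    Matrix.det (Matrix.of fun j k => g c (x j) (y k) / h c (x j) (y k))

/-- The `n`-element subsets `α` of the index set `{1, …, a}`; such a subset encodes the partition
of `ū = {u₁, …, u_a}` into `ū_α` and its complement. -/
abbrev Sub (a n : ℕ) : Type := {s : Finset (Fin a) // s.card = n}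

/-- The subset `ū_α`, in its natural order, as an `n`-tuple. -/
def Sub.tuple {a n : ℕ} (α : Sub a n) (u : Fin a → ℂ) : Fin n → ℂ :=
  fun i => u (α.1.orderEmbOfFin α.2 i)

/-- The coefficient `g(v̄_β, ū_α) f(ū_α, ū_ᾱ) g(v̄_β̄, v̄_β) h(ū_α, ū_α)`. -/
def coeffX (c : ℂ) {a b n : ℕ} (u : Fin a → ℂ) (v : Fin b → ℂ) (α : Sub a n) (β : Sub b n) : ℂ :=
  prod₂ (g c) v β.1 u α.1 * prod₂ (f c) u α.1 u α.1ᶜ * prod₂ (g c) v β.1ᶜ v β.1 *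
    prod₂ (h c) u α.1 u α.1

/-- The coefficient `K(v̄_β | ū_α) f(ū_α, ū_ᾱ) g(v̄_β̄, v̄_β)`. -/
def coeffY (c : ℂ) {a b n : ℕ} (u : Fin a → ℂ) (v : Fin b → ℂ) (α : Sub a n) (β : Sub b n) : ℂ :=
  dwpf c (β.tuple v) (α.tuple u) * prod₂ (f c) u α.1 u α.1ᶜ * prod₂ (g c) v β.1ᶜ v β.1

section Operators

variable {A : Type*} [Ring A] [Algebra ℂ A]

/-- The terms of `X_{a,b}(ū, v̄)` with `#ū_α = #v̄_β = n`. -/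
def partX (c : ℂ) (T : Fin 3 → Fin 3 → ℂ → A) {a b : ℕ} (u : Fin a → ℂ) (v : Fin b → ℂ)
    (n : ℕ) : A :=
  ∑ α : Sub a n, ∑ β : Sub b n, coeffX c u v α β •
    (colT c T 0 u α.1 * ordProd (T 0 1) u α.1ᶜ * colT c T 1 v β.1ᶜ * ordProd (T 1 1) v β.1)

/-- The terms of `Y_{a,b}(ū, v̄)` with `#ū_α = #v̄_β = n`. -/
def partY (c : ℂ) (T : Fin 3 → Fin 3 → ℂ → A) {a b : ℕ} (u : Fin a → ℂ) (v : Fin b → ℂ)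
    (n : ℕ) : A :=
  ∑ α : Sub a n, ∑ β : Sub b n, coeffY c u v α β •
    (colT c T 0 v β.1 * colT c T 1 v β.1ᶜ * ordProd (T 0 1) u α.1ᶜ * ordProd (T 1 1) u α.1)

/-- The operator `X_{a,b}(ū, v̄)`. -/
def opX (c : ℂ) (T : Fin 3 → Fin 3 → ℂ → A) {a b : ℕ} (u : Fin a → ℂ) (v : Fin b → ℂ) : A :=
  ∑ n ∈ range (min a b + 1), partX c T u v n

/-- The operator `Y_{a,b}(ū, v̄)`. -/
def opY (c : ℂ) (T : Fin 3 → Fin 3 → ℂ → A) {a b : ℕ} (u : Fin a → ℂ) (v : Fin b → ℂ) : A :=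
  ∑ n ∈ range (min a b + 1), partY c T u v n

end Operators

/-! The antimorphism `ψ`, on polynomials in the noncommuting symbols `T_{ij}(u)`. -/

/-- The symbols `T_{ij}(u)`. -/
abbrev Gen : Type := Fin 3 × Fin 3 × ℂ

/-- `T_{ij}(u)` as a generator of the free algebra. -/
def genT (i j : Fin 3) (u : ℂ) : FreeAlgebra ℂ Gen := FreeAlgebra.ι ℂ (i, j, u)

/-- The parity of the monomial with the given letters. -/
def wordPar (w : List Gen) : ℕ := (w.map fun x => par x.1 + par x.2.1).sum

/-- `ψ` on monomials: `ψ(T_{ij}(u)) = (-1)^([i][j]+[i]) T_{ji}(u)` and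
`ψ(x w) = (-1)^([x][w]) ψ(w) ψ(x)`. -/
def psiWord : List Gen → FreeAlgebra ℂ Gen
  | [] => 1
  | x :: w => ((-1 : ℂ) ^ ((par x.1 + par x.2.1) * wordPar w)) •
      (psiWord w * (((-1 : ℂ) ^ (par x.1 * par x.2.1 + par x.1)) • genT x.2.1 x.1 x.2.2))

/-- The linear map `ψ`. -/
def psi : FreeAlgebra ℂ Gen →ₗ[ℂ] FreeAlgebra ℂ Gen :=
  (FreeAlgebra.basisFreeMonoid ℂ Gen).constr ℂ fun w => psiWord w.toList

section Vectors

variable {H : Type*} [AddCommGroup H] [Module ℂ H]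

/-- The value of a noncommutative polynomial in the symbols `T_{ij}(u)` on given operators. -/
def evalT (T : Fin 3 → Fin 3 → ℂ → Module.End ℂ H) : FreeAlgebra ℂ Gen →ₐ[ℂ] Module.End ℂ H :=
  FreeAlgebra.lift ℂ fun x => T x.1 x.2.1 x.2.2

/-- `Ω` is a pseudovacuum with eigenvalues `lam i u`. -/
def IsVacuum (D : Set ℂ) (T : Fin 3 → Fin 3 → ℂ → Module.End ℂ H) (lam : Fin 3 → ℂ → ℂ) (Ω : H) :
    Prop :=
  (∀ i, ∀ u ∈ D, T i i u Ω = lam i u • Ω) ∧ ∀ i j, j < i → ∀ u ∈ D, T i j u Ω = 0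

/-- `Ω'` is a dual pseudovacuum with eigenvalues `lam i u`; operators act on the dual space from
the right, by composition. -/
def IsDualVacuum (D : Set ℂ) (T : Fin 3 → Fin 3 → ℂ → Module.End ℂ H) (lam : Fin 3 → ℂ → ℂ)
    (Ω' : Module.Dual ℂ H) : Prop :=
  (∀ i, ∀ u ∈ D, Ω' ∘ₗ T i i u = lam i u • Ω') ∧ ∀ i j, i < j → ∀ u ∈ D, Ω' ∘ₗ T i j u = 0

/-- The Bethe vector `Φ_{a,b}(ū, v̄) = X_{a,b}(ū, v̄) Ω`. -/
def bethe (c : ℂ) (T : Fin 3 → Fin 3 → ℂ → Module.End ℂ H) (Ω : H) {a b : ℕ}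
    (u : Fin a → ℂ) (v : Fin b → ℂ) : H :=
  opX c T u v Ω

/-- The dual Bethe vector, the image `Ω' ψ(X_{a,b}(ū, v̄))` of the Bethe vector under `ψ`. -/
def dualBethe (c : ℂ) (T : Fin 3 → Fin 3 → ℂ → Module.End ℂ H) (Ω' : Module.Dual ℂ H) {a b : ℕ}
    (u : Fin a → ℂ) (v : Fin b → ℂ) : Module.Dual ℂ H :=
  Ω' ∘ₗ evalT T (psi (opX c genT u v))

end Vectors

end

end SuperYangian

/-! Write a, d, s, t for T₁₂, T₂₂, T₂₃, T₁₃. Part 1 uses only the exchange relations among these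
four families, collected in `IsExchangeFamily`. The parameters ū and v̄ are treated as two disjoint
subsets U, V of one family x, because the induction moves elements of V into U.

Both operators satisfy a recursion that removes one element o from U, with the same coefficients r_j
(`recCoeff`): X(o∪U, V) = a_o X(U, V) + ∑_j r_j t_o X(U, V∖j) d_j (`sumX_insert`), Y(o∪U, V) = Y(U,
V) a_o + ∑_j r_j t_j Y(U, V∖j) d_o (`sumY_insert`). In X the operator a_o is carried to the left
through the t's, in Y to the right through the d's. Comparing coefficients of equal monomials leaves
scalar identities. These are residue theorems for rational functions (`sum_residues`), supplemented
for Y by the reduction of the domain wall partition function K by one pair of variables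
(`dwpfOn_insert`).

X = Y follows by strong induction on #U. For U = ∅ both are the product of the s's; for one element
the claim is the commutator of a with that product (`a_mul_divH_sub`). For two more elements o, q,
the first is peeled off on the left by the recursion of X and the second on the right by that of Y,
in either order (`sumX_insert_insert_eq`). The two results differ by terms t_o [a_j, B] d_q with B =
X(U, V∖j), and by terms quadratic in t. The commutator [a_j, B] is known from the induction
hypothesis for j∪U and V∖j, and then a scalar identity (`recCoeff_cancel`) removes everything.

Part 2 is the action of the diagonal entries T₂₂ on the vacuum. For part 3, ψ is a graded
antimorphism. Multiplying odd entries by −i turns it into an ordinary antimorphism, so the twisted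
entries satisfy the original relations in the opposite algebra (`IsMonodromy.twist`), where part 1
applies again. The b odd factors account for the sign (−1)^(b(b−1)/2). -/

namespace SuperYangian

noncomputable section

/-! ### Ordered products symmetrised by scalar weights -/

section WeightedProducts

variable {ι A : Type*} [LinearOrder ι] [Ring A] [Algebra ℂ A]

/-- The increasing product of the `t i`, `i ∈ s`, times the product of the weights `w m l` over
`m < l`. -/
def wprod (w : ι → ι → ℂ) (t : ι → A) (s : Finset ι) : A :=
  (∏ l ∈ s, ∏ m ∈ s with m < l, w m l) • (s.sort.map t).prod

@[simp]
theorem wprod_empty (w : ι → ι → ℂ) (t : ι → A) : wprod w t ∅ = 1 := by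
  simp [wprod]

theorem wprod_insert_min (w : ι → ι → ℂ) (t : ι → A) {s : Finset ι} {m : ι}
    (hm : ∀ j ∈ s, m < j) :
    wprod w t (insert m s) = (∏ j ∈ s, w m j) • (t m * wprod w t s) := by
  have hms : m ∉ s := fun hh => lt_irrefl _ (hm m hh)
  rw [wprod, wprod, sort_insert _ (fun j hj => (hm j hj).le) hms, prod_insert hms,
    List.map_cons, List.prod_cons, mul_smul_comm, smul_smul]
  congr 1
  have h1 : (∏ k ∈ insert m s with k < m, w k m) = 1 := by
    apply prod_eq_one
    intro k hk
    obtain ⟨hk, hlt⟩ := mem_filter.mp hk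
    rcases mem_insert.mp hk with rfl | hk
    · exact absurd hlt (lt_irrefl _)
    · exact absurd hlt (hm k hk).not_gt
  rw [h1, one_mul, ← prod_mul_distrib]
  refine prod_congr rfl fun l hl => ?_
  rw [filter_insert, if_pos (hm l hl), prod_insert (by simp [hms])]

/-- The weighted product is symmetric: any factor can be extracted on the left. -/
theorem wprod_insert_left {w : ι → ι → ℂ} {t : ι → A} {s : Finset ι}
    {i : ι} (his : i ∉ s)
    (hw : ∀ j ∈ insert i s, ∀ k ∈ insert i s, j ≠ k →
      w j k • (t j * t k) = w k j • (t k * t j)) :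
    wprod w t (insert i s) = (∏ j ∈ s, w i j) • (t i * wprod w t s) := by
  induction s using Finset.induction_on_min with
  | empty => exact wprod_insert_min w t (by simp)
  | insert m s hm ih =>
    have hms : m ∉ s := fun hh => lt_irrefl _ (hm m hh)
    have him : i ≠ m := fun hh => his (hh ▸ mem_insert_self _ _)
    have his' : i ∉ s := fun hh => his (mem_insert_of_mem hh)
    rcases lt_or_gt_of_ne him with hlt | hlt
    · refine wprod_insert_min w t fun j hj => ?_
      rcases mem_insert.mp hj with rfl | hj
      · exact hlt
      · exact hlt.trans (hm j hj)
    · rw [insert_comm, wprod_insert_min w t (s := insert i s) (m := m), ih his', prod_insert his',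
        prod_insert hms, wprod_insert_min w t hm]
      · simp only [mul_smul_comm, smul_smul, ← mul_assoc]
        have := hw m (by simp) i (by simp) him.symm
        calc (w m i * (∏ j ∈ s, w m j) * ∏ j ∈ s, w i j) • (t m * t i * wprod w t s)
            = ((∏ j ∈ s, w m j) * ∏ j ∈ s, w i j) • ((w m i • (t m * t i)) * wprod w t s) := by
              rw [smul_mul_assoc, smul_smul]; congr 1; ring
          _ = _ := by
              rw [this, smul_mul_assoc, smul_smul]; congr 1; ring
      · intro j hj k hk hjk
        exact hw j (by simp only [mem_insert] at hj ⊢; tauto) k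
          (by simp only [mem_insert] at hk ⊢; tauto) hjk
      · intro j hj
        rcases mem_insert.mp hj with rfl | hj
        · exact hlt
        · exact hm j hj

/-- The weighted product is symmetric: any factor can be extracted on the right. -/
theorem wprod_insert_right {w : ι → ι → ℂ} {t : ι → A} {s : Finset ι}
    {i : ι} (his : i ∉ s)
    (hw : ∀ j ∈ insert i s, ∀ k ∈ insert i s, j ≠ k →
      w j k • (t j * t k) = w k j • (t k * t j)) :
    wprod w t (insert i s) = (∏ j ∈ s, w j i) • (wprod w t s * t i) := by
  induction s using Finset.induction_on with
  | empty => rw [wprod_insert_min w t (s := ∅) (m := i) (by simp)]; simp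
  | insert m s hms ih =>
    have him : m ≠ i := fun hh => his (hh ▸ mem_insert_self _ _)
    have his' : i ∉ s := fun hh => his (mem_insert_of_mem hh)
    have hmi : m ∉ insert i s := by simp [hms, him]
    rw [insert_comm, wprod_insert_left hmi (by rw [insert_comm]; exact hw), ih his',
      prod_insert his', prod_insert hms, wprod_insert_left hms]
    · simp only [mul_smul_comm, smul_mul_assoc, smul_smul, mul_assoc]
      congr 1; ring
    · intro j hj k hk hjk
      exact hw j (mem_insert_of_mem hj) k (mem_insert_of_mem hk) hjk
    · intro j hj k hk hjk
      exact hw j (by simp only [mem_insert] at hj ⊢; tauto) k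
        (by simp only [mem_insert] at hk ⊢; tauto) hjk

end WeightedProducts

/-! ### The rational functions g, f, h -/

section Scalars

variable {c : ℂ}

theorem f_eq_one_add_g {x y : ℂ} (hxy : x ≠ y) : f c x y = 1 + g c x y := by
  have : x - y ≠ 0 := sub_ne_zero.mpr hxy
  rw [f, g]; field_simp

theorem f_eq_g_mul_h (hc : c ≠ 0) (x y : ℂ) : f c x y = g c x y * h c x y := by
  rw [f, g, h]
  rcases eq_or_ne (x - y) 0 with h0 | h0
  · simp [h0]
  · field_simp

theorem g_swap (x y : ℂ) : g c y x = -g c x y := by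
  rw [g, g, ← neg_sub, div_neg]

/-- Partial fractions, from (x − y) + (y − z) = x − z. -/
theorem g_mul_g {x y z : ℂ} (hxy : x ≠ y) (hyz : y ≠ z) (hxz : x ≠ z) :
    g c y z * g c x y = g c x z * (g c y z + g c x y) := by
  have h1 := sub_ne_zero.mpr hxy
  have h2 := sub_ne_zero.mpr hyz
  have h3 := sub_ne_zero.mpr hxz
  rw [g, g, g]; field_simp; ring

theorem g_mul_h_swap (hc : c ≠ 0) {x y : ℂ} (hxy : x ≠ y) : g c x y * h c y x = g c x y - 1 := by
  have h1 := sub_ne_zero.mpr hxy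
  rw [g, h]; field_simp; ring

theorem h_self (hc : c ≠ 0) (x : ℂ) : h c x x = 1 := by
  rw [h, sub_self, zero_add, div_self hc]

theorem h_ne_zero (hc : c ≠ 0) {x y : ℂ} (hxy : x - y + c ≠ 0) : h c x y ≠ 0 :=
  div_ne_zero hxy hc

end Scalars

/-! ### Carrying one operator through a symmetric product -/

section Exchange

variable {ι A : Type*} [LinearOrder ι] [Ring A] [Algebra ℂ A] {c : ℂ} {x : ι → ℂ}

/-- The usual argument of the algebraic Bethe ansatz: either `b` keeps its parameter throughout, or
it trades it with exactly one `t i`. Peeling off the leftmost `t j` gives two contributions to each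
exchange term, which the three-term identity for g merges. Condition `hhw` on the weights holds both
for h(x_i, x_j) and for 1 / h(x_j, x_i), so one lemma serves `mulH` and `divH`. -/
theorem mul_wprod (hc : c ≠ 0) (hx : Function.Injective x) {w : ι → ι → ℂ} {b t : ι → A}
    (hbt : ∀ i j, i ≠ j →
      b i * t j = f c (x j) (x i) • (t j * b i) - g c (x j) (x i) • (t i * b j))
    (htt : ∀ i j, i ≠ j → h c (x i) (x j) • (t i * t j) = h c (x j) (x i) • (t j * t i))
    {α : Finset ι}
    (hw : ∀ i ∈ α, ∀ j ∈ α, i ≠ j → w i j • (t i * t j) = w j i • (t j * t i))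
    (hhw : ∀ i ∈ α, ∀ j ∈ α, i ≠ j → h c (x j) (x i) * w i j = h c (x i) (x j) * w j i)
    {o : ι} (ho : o ∉ α) :
    b o * wprod w t α = (∏ i ∈ α, f c (x i) (x o)) • (wprod w t α * b o)
      - ∑ i ∈ α, (g c (x i) (x o) * (∏ j ∈ α.erase i, w i j) *
          ∏ j ∈ α.erase i, f c (x j) (x i)) • (t o * wprod w t (α.erase i) * b i) := by
  induction α using Finset.induction_on generalizing o with
  | empty => simp
  | insert j α hj ih =>
    have hoj : o ≠ j := fun hh => ho (hh ▸ mem_insert_self _ _)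
    have hoα : o ∉ α := fun hh => ho (mem_insert_of_mem hh)
    have ih' := fun {o : ι} => ih (o := o)
      (fun i hi k hk => hw i (mem_insert_of_mem hi) k (mem_insert_of_mem hk))
      (fun i hi k hk => hhw i (mem_insert_of_mem hi) k (mem_insert_of_mem hk))
    have key : ∀ i ∈ α, (g c (x i) (x o) * (∏ k ∈ (insert j α).erase i, w i k) *
          ∏ k ∈ (insert j α).erase i, f c (x k) (x i)) •
            (t o * wprod w t ((insert j α).erase i) * b i)
        = (∏ k ∈ α, w j k) • (f c (x j) (x o) • (t j * ((g c (x i) (x o) *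
            (∏ k ∈ α.erase i, w i k) * ∏ k ∈ α.erase i, f c (x k) (x i)) •
            (t o * wprod w t (α.erase i) * b i)))
          - g c (x j) (x o) • (t o * ((g c (x i) (x j) *
            (∏ k ∈ α.erase i, w i k) * ∏ k ∈ α.erase i, f c (x k) (x i)) •
            (t j * wprod w t (α.erase i) * b i)))) := by
      intro i hi
      have hij : i ≠ j := fun hh => hj (hh ▸ hi)
      have hoi : o ≠ i := fun hh => hoα (hh ▸ hi)
      have hji : j ∉ α.erase i := fun hh => hj (mem_of_mem_erase hh)
      have e1 : (insert j α).erase i = insert j (α.erase i) := erase_insert_of_ne hij.symm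
      have e2 : wprod w t (insert j (α.erase i))
          = (∏ k ∈ α.erase i, w j k) • (t j * wprod w t (α.erase i)) := by
        refine wprod_insert_left hji fun k hk l hl hkl => hw k ?_ l ?_ hkl
        · exact insert_subset_insert _ (erase_subset _ _) hk
        · exact insert_subset_insert _ (erase_subset _ _) hl
      -- f = g h, the symmetry of the t's transposes h, and g(x_j, x_o) h(x_o, x_j) = g(x_j, x_o) −
      -- 1.
      have e3 : f c (x j) (x o) • (t j * t o)
          = (g c (x j) (x o) - 1) • (t o * t j) := by
        rw [f_eq_g_mul_h hc, mul_smul, htt j o hoj.symm, smul_smul,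
          g_mul_h_swap hc (hx.ne hoj.symm)]
      have e4 : f c (x j) (x o) • (t j * ((g c (x i) (x o) *
            (∏ k ∈ α.erase i, w i k) * ∏ k ∈ α.erase i, f c (x k) (x i)) •
            (t o * wprod w t (α.erase i) * b i)))
          = ((g c (x j) (x o) - 1) * (g c (x i) (x o) *
            (∏ k ∈ α.erase i, w i k) * ∏ k ∈ α.erase i, f c (x k) (x i))) •
            (t o * (t j * (wprod w t (α.erase i) * b i))) := by
        generalize g c (x i) (x o) * (∏ k ∈ α.erase i, w i k) * ∏ k ∈ α.erase i, f c (x k) (x i) = r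
        have e4' := congrArg (fun z => r • (z * (wprod w t (α.erase i) * b i))) e3
        simp only [smul_mul_assoc, mul_smul_comm, smul_smul, mul_assoc] at e4' ⊢
        rw [mul_comm (f c (x j) (x o)), e4', mul_comm r]
      have e5 := hhw i (mem_insert_of_mem hi) j (mem_insert_self _ _) hij
      have e6 : g c (x i) (x o) * w i j * f c (x j) (x i)
          = w j i * ((g c (x j) (x o) - 1) * g c (x i) (x o)
            - g c (x j) (x o) * g c (x i) (x j)) := by
        have q1 := g_mul_h_swap hc (hx.ne hij.symm)
        have q2 := g_mul_g (c := c) (hx.ne hij) (hx.ne hoj.symm) (hx.ne hoi.symm)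
        have q3 := g_swap (c := c) (x i) (x j)
        rw [f_eq_g_mul_h hc]
        linear_combination g c (x i) (x o) * g c (x j) (x i) * e5
          + g c (x i) (x o) * w j i * q1 + g c (x i) (x o) * w j i * q3 + w j i * q2
      have e7 : (∏ k ∈ α, w j k) = w j i * ∏ k ∈ α.erase i, w j k := (mul_prod_erase _ _ hi).symm
      rw [e4, e1, e2, e7, prod_insert hji, prod_insert hji]
      simp only [mul_smul_comm, smul_mul_assoc, smul_smul, mul_assoc, ← sub_smul]
      congr 1
      linear_combination (∏ k ∈ α.erase i, w i k) * (∏ k ∈ α.erase i, f c (x k) (x i)) *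
        (∏ k ∈ α.erase i, w j k) * e6
    rw [sum_insert hj, sum_congr rfl key, ← smul_sum, sum_sub_distrib, ← smul_sum, ← smul_sum,
      ← mul_sum, ← mul_sum, erase_insert hj, prod_insert hj, wprod_insert_left hj hw]
    have h1 := ih' hoα
    have h2 := ih' hj
    have h3 : ∑ i ∈ α, (g c (x i) (x o) * (∏ j ∈ α.erase i, w i j) *
          ∏ j ∈ α.erase i, f c (x j) (x i)) • (t o * wprod w t (α.erase i) * b i)
        = (∏ i ∈ α, f c (x i) (x o)) • (wprod w t α * b o) - b o * wprod w t α := by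
      rw [h1]; abel
    have h4 : ∑ i ∈ α, (g c (x i) (x j) * (∏ j ∈ α.erase i, w i j) *
          ∏ j ∈ α.erase i, f c (x j) (x i)) • (t j * wprod w t (α.erase i) * b i)
        = (∏ i ∈ α, f c (x i) (x j)) • (wprod w t α * b j) - b j * wprod w t α := by
      rw [h2]; abel
    rw [h3, h4, mul_smul_comm, ← mul_assoc, hbt o j hoj]
    simp only [sub_mul, mul_sub, smul_sub, mul_smul_comm, smul_mul_assoc, smul_smul, mul_assoc]
    have h5 : (∏ k ∈ α, w j k) * (f c (x j) (x o) * ∏ i ∈ α, f c (x i) (x o))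
        = f c (x j) (x o) * ((∏ i ∈ α, f c (x i) (x o)) * ∏ k ∈ α, w j k) := by ring
    have h6 : (∏ k ∈ α, w j k) * (g c (x j) (x o) * ∏ i ∈ α, f c (x i) (x j))
        = g c (x j) (x o) * ((∏ k ∈ α, w j k) * ∏ i ∈ α, f c (x i) (x j)) := by ring
    rw [h5, h6]
    abel

/-- Mirror image of `mul_wprod`: the single operator starts on the right, and the commuting d's need
no weight. The induction peels off the rightmost `d j`. -/
theorem wprod_one_mul (hx : Function.Injective x) {a d : ι → A}
    (hda : ∀ i j, i ≠ j →
      d i * a j = f c (x i) (x j) • (a j * d i) - g c (x i) (x j) • (a i * d j))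
    (hdd : ∀ i j, d i * d j = d j * d i) {α : Finset ι} {o : ι} (ho : o ∉ α) :
    wprod 1 d α * a o = (∏ i ∈ α, f c (x i) (x o)) • (a o * wprod 1 d α)
      - ∑ i ∈ α, (g c (x i) (x o) * ∏ j ∈ α.erase i, f c (x j) (x i)) •
          (a i * wprod 1 d (α.erase i) * d o) := by
  have ins : ∀ {s : Finset ι} {j : ι}, j ∉ s → wprod 1 d (insert j s) = wprod 1 d s * d j := by
    intro s j hj
    rw [wprod_insert_right hj fun j _ k _ _ => by simp [hdd j k]]
    simp
  induction α using Finset.induction_on generalizing o with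
  | empty => simp
  | insert j α hj ih =>
    have hoj : o ≠ j := fun hh => ho (hh ▸ mem_insert_self _ _)
    have hoα : o ∉ α := fun hh => ho (mem_insert_of_mem hh)
    have key : ∀ i ∈ α, (g c (x i) (x o) * ∏ k ∈ (insert j α).erase i, f c (x k) (x i)) •
          (a i * wprod 1 d ((insert j α).erase i) * d o)
        = f c (x j) (x o) • (((g c (x i) (x o) * ∏ k ∈ α.erase i, f c (x k) (x i)) •
            (a i * wprod 1 d (α.erase i) * d o)) * d j)
          - g c (x j) (x o) • (((g c (x i) (x j) * ∏ k ∈ α.erase i, f c (x k) (x i)) •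
            (a i * wprod 1 d (α.erase i) * d j)) * d o) := by
      intro i hi
      have hij : i ≠ j := fun hh => hj (hh ▸ hi)
      have hoi : o ≠ i := fun hh => hoα (hh ▸ hi)
      have hji : j ∉ α.erase i := fun hh => hj (mem_of_mem_erase hh)
      rw [erase_insert_of_ne hij.symm, ins hji, prod_insert hji]
      simp only [smul_mul_assoc, smul_smul, mul_assoc, hdd o j, ← sub_smul]
      congr 1
      have q2 := g_mul_g (c := c) (hx.ne hij) (hx.ne hoj.symm) (hx.ne hoi.symm)
      have q3 := g_swap (c := c) (x i) (x j)
      rw [f_eq_one_add_g (hx.ne hij.symm), f_eq_one_add_g (hx.ne hoj.symm)]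
      linear_combination (∏ k ∈ α.erase i, f c (x k) (x i)) * (q2 + g c (x i) (x o) * q3)
    have h3 : ∑ i ∈ α, (g c (x i) (x o) * ∏ j ∈ α.erase i, f c (x j) (x i)) •
          (a i * wprod 1 d (α.erase i) * d o)
        = (∏ i ∈ α, f c (x i) (x o)) • (a o * wprod 1 d α) - wprod 1 d α * a o := by
      rw [ih hoα]; abel
    have h4 : ∑ i ∈ α, (g c (x i) (x j) * ∏ j ∈ α.erase i, f c (x j) (x i)) •
          (a i * wprod 1 d (α.erase i) * d j)
        = (∏ i ∈ α, f c (x i) (x j)) • (a j * wprod 1 d α) - wprod 1 d α * a j := by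
      rw [ih hj]; abel
    rw [sum_insert hj, sum_congr rfl key, sum_sub_distrib, ← smul_sum, ← smul_sum,
      ← sum_mul, ← sum_mul, erase_insert hj, prod_insert hj, ins hj, h3, h4, mul_assoc,
      hda j o hoj.symm]
    simp only [sub_mul, mul_sub, smul_sub, mul_smul_comm, smul_mul_assoc, smul_smul, mul_assoc]
    abel

end Exchange

/-! ### Residue identities -/

section Residues

variable {ι : Type*} [DecidableEq ι] {c : ℂ} {x : ι → ℂ}

-- By Lagrange interpolation the sum is the coefficient of X^(#S − 1) in P. Equivalently, it is the
-- sum of the finite residues of P(z) / ∏ (z − x_i), which decays fast enough at infinity.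
open Polynomial in
theorem sum_eval_div_prod_sub_eq_zero (hx : Function.Injective x) {S : Finset ι} {P : ℂ[X]}
    (hP : P.natDegree + 1 < #S) :
    ∑ i ∈ S, P.eval (x i) / ∏ j ∈ S.erase i, (x i - x j) = 0 := by
  have h1 : P.degree < #S :=
    lt_of_le_of_lt P.degree_le_natDegree (by exact_mod_cast (by omega : P.natDegree < #S))
  rw [← Lagrange.coeff_eq_sum hx.injOn h1]
  exact coeff_eq_zero_of_natDegree_lt (by omega)

theorem prod_sub_swap {ι : Type*} {x : ι → ℂ} (s : Finset ι) (z : ℂ) :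
    ∏ k ∈ s, (x k - z) = (-1) ^ #s * ∏ k ∈ s, (z - x k) := by
  rw [← prod_const, ← prod_mul_distrib]
  exact prod_congr rfl fun k _ => by ring

-- Residues of ∏_{γ∪α} (z − x_i + c) divided by (z − x_o) ∏_{γ∪β} (z − x_k). Since #β = #α + 1, the
-- denominator has degree two more than the numerator, so they add up to zero. The poles at o and γ
-- give the left side, those at β the right side.
open Polynomial in
theorem sum_residues (hc : c ≠ 0) (hx : Function.Injective x) {α β γ : Finset ι} {o : ι}
    (hoβ : o ∉ β) (hoγ : o ∉ γ) (hβγ : Disjoint γ β) (hcard : #β = #α + 1) :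
    (∏ k ∈ β, g c (x k) (x o)) * (∏ i ∈ γ, f c (x o) (x i)) * (∏ k ∈ α, h c (x o) (x k))
      + ∑ i ∈ γ, g c (x i) (x o) * (∏ k ∈ β, g c (x k) (x i)) *
          (∏ k ∈ γ.erase i, f c (x i) (x k)) * (∏ k ∈ α, h c (x i) (x k))
      = ∑ j ∈ β, g c (x j) (x o) * (∏ i ∈ γ, f c (x j) (x i)) * (∏ k ∈ α, h c (x j) (x k)) *
          ∏ k ∈ β.erase j, g c (x k) (x j) := by
  set P : ℂ[X] := (∏ i ∈ γ, (X - C (x i - c))) * ∏ i ∈ α, (X - C (x i - c)) with hPdef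
  have hoS : o ∉ γ ∪ β := by simp [hoβ, hoγ]
  have hdeg : P.natDegree + 1 < #(insert o (γ ∪ β)) := by
    rw [card_insert_of_notMem hoS, card_union_of_disjoint hβγ, hcard]
    have : P.natDegree ≤ #γ + #α := by
      refine natDegree_mul_le.trans (add_le_add ?_ ?_) <;>
        rw [natDegree_prod_of_monic _ _ fun i _ => monic_X_sub_C _] <;>
        simp only [natDegree_X_sub_C, sum_const, smul_eq_mul, mul_one, le_refl]
    omega
  have heval : ∀ z, P.eval z = (∏ i ∈ γ, (z - x i + c)) * ∏ i ∈ α, (z - x i + c) := by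
    intro z
    simp only [hPdef, eval_mul, eval_prod, eval_sub, eval_X, eval_C]
    congr 1 <;> exact prod_congr rfl fun i _ => by ring
  have H := sum_eval_div_prod_sub_eq_zero hx hdeg
  rw [sum_insert hoS, sum_union hβγ, erase_insert hoS, prod_union hβγ] at H
  have eo : P.eval (x o) / ((∏ k ∈ γ, (x o - x k)) * ∏ k ∈ β, (x o - x k))
      = (-1) ^ #β / c * ((∏ k ∈ β, g c (x k) (x o)) * (∏ i ∈ γ, f c (x o) (x i)) *
        (∏ k ∈ α, h c (x o) (x k))) := by
    have n1 : ∏ k ∈ γ, (x o - x k) ≠ 0 := prod_ne_zero_iff.mpr fun k hk =>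
      sub_ne_zero.mpr (hx.ne fun hh => hoγ (hh ▸ hk))
    have n2 : ∏ k ∈ β, (x o - x k) ≠ 0 := prod_ne_zero_iff.mpr fun k hk =>
      sub_ne_zero.mpr (hx.ne fun hh => hoβ (hh ▸ hk))
    rw [heval]
    simp only [g, f, h, prod_div_distrib, prod_const]
    rw [prod_sub_swap β, hcard]
    field_simp
    ring_nf
  have ei : ∀ i ∈ γ, P.eval (x i) / ∏ k ∈ (insert o (γ ∪ β)).erase i, (x i - x k)
      = (-1) ^ #β / c * (g c (x i) (x o) * (∏ k ∈ β, g c (x k) (x i)) *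
          (∏ k ∈ γ.erase i, f c (x i) (x k)) * (∏ k ∈ α, h c (x i) (x k))) := by
    intro i hi
    have hiβ : i ∉ β := disjoint_left.mp hβγ hi
    have hio : i ≠ o := fun hh => hoγ (hh ▸ hi)
    have n1 : ∏ k ∈ γ.erase i, (x i - x k) ≠ 0 := prod_ne_zero_iff.mpr fun k hk =>
      sub_ne_zero.mpr (hx.ne (ne_of_mem_erase hk).symm)
    have n2 : ∏ k ∈ β, (x i - x k) ≠ 0 := prod_ne_zero_iff.mpr fun k hk =>
      sub_ne_zero.mpr (hx.ne fun hh => hiβ (hh ▸ hk))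
    have n3 : x i - x o ≠ 0 := sub_ne_zero.mpr (hx.ne hio)
    have hS : (insert o (γ ∪ β)).erase i = insert o (γ.erase i ∪ β) := by
      rw [erase_insert_of_ne hio.symm, erase_union_distrib, erase_eq_of_notMem hiβ]
    rw [hS, prod_insert (by simp [hoβ, hoγ]),
      prod_union (hβγ.mono_left (erase_subset _ _)), heval, ← mul_prod_erase γ _ hi]
    simp only [g, f, h, prod_div_distrib, prod_const]
    rw [prod_sub_swap β, hcard]
    field_simp
    ring_nf
  have ej : ∀ j ∈ β, P.eval (x j) / ∏ k ∈ (insert o (γ ∪ β)).erase j, (x j - x k)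
      = (-1) ^ #β / c * (-(g c (x j) (x o) * (∏ i ∈ γ, f c (x j) (x i)) *
          (∏ k ∈ α, h c (x j) (x k)) * ∏ k ∈ β.erase j, g c (x k) (x j))) := by
    intro j hj
    have hjγ : j ∉ γ := disjoint_right.mp hβγ hj
    have hjo : j ≠ o := fun hh => hoβ (hh ▸ hj)
    have n1 : ∏ k ∈ β.erase j, (x j - x k) ≠ 0 := prod_ne_zero_iff.mpr fun k hk =>
      sub_ne_zero.mpr (hx.ne (ne_of_mem_erase hk).symm)
    have n2 : ∏ k ∈ γ, (x j - x k) ≠ 0 := prod_ne_zero_iff.mpr fun k hk =>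
      sub_ne_zero.mpr (hx.ne fun hh => hjγ (hh ▸ hk))
    have n3 : x j - x o ≠ 0 := sub_ne_zero.mpr (hx.ne hjo)
    have hS : (insert o (γ ∪ β)).erase j = insert o (γ ∪ β.erase j) := by
      rw [erase_insert_of_ne hjo.symm, erase_union_distrib, erase_eq_of_notMem hjγ]
    have hcj : #(β.erase j) = #α := by rw [card_erase_of_mem hj, hcard]; rfl
    rw [hS, prod_insert (by simp [hoβ, hoγ]),
      prod_union (hβγ.mono_right (erase_subset _ _)), heval]
    simp only [g, f, h, prod_div_distrib, prod_const]
    rw [prod_sub_swap (β.erase j), hcj, hcard]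
    generalize ∏ i ∈ γ, (x j - x i + c) = r
    generalize ∏ i ∈ α, (x j - x i + c) = q
    field_simp
    ring
  rw [eo, sum_congr rfl ei, sum_congr rfl ej, ← mul_sum, ← mul_sum, ← mul_add, ← mul_add,
    sum_neg_distrib] at H
  have := (mul_eq_zero.mp H).resolve_left (div_ne_zero (pow_ne_zero _ (by norm_num)) hc)
  linear_combination this

theorem sum_residues_left (hc : c ≠ 0) (hx : Function.Injective x) {γ : Finset ι} {o p : ι}
    (hop : o ≠ p) (hoγ : o ∉ γ) (hpγ : p ∉ γ) :
    g c (x p) (x o) * (∏ i ∈ γ, f c (x o) (x i))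
      + ∑ i ∈ γ, g c (x i) (x o) * g c (x p) (x i) * (∏ k ∈ γ.erase i, f c (x i) (x k))
      = g c (x p) (x o) * ∏ i ∈ γ, f c (x p) (x i) := by
  have := sum_residues hc hx (α := ∅) (β := {p}) (γ := γ) (o := o) (by simpa using hop) hoγ
    (by simpa using hpγ) (by simp)
  simpa using this

/-- The substitution c ↦ −c turns g into −g and exchanges the arguments of f. -/
theorem sum_residues_right (hc : c ≠ 0) (hx : Function.Injective x) {γ : Finset ι} {o p : ι}
    (hop : o ≠ p) (hoγ : o ∉ γ) (hpγ : p ∉ γ) :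
    g c (x p) (x o) * (∏ i ∈ γ, f c (x i) (x o))
      - ∑ i ∈ γ, g c (x i) (x o) * g c (x p) (x i) * (∏ k ∈ γ.erase i, f c (x k) (x i))
      = g c (x p) (x o) * ∏ i ∈ γ, f c (x i) (x p) := by
  have hg : ∀ y z, g (-c) y z = -g c y z := fun y z => by simp [g, neg_div]
  have hf : ∀ y z, f (-c) y z = f c z y := fun y z => by
    rw [f, f, ← neg_sub z y, ← neg_add, neg_div_neg_eq]
  have := sum_residues_left (neg_ne_zero.mpr hc) hx hop hoγ hpγ
  simp only [hg, hf, neg_mul, mul_neg, neg_neg] at this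
  linear_combination -this

end Residues

/-! ### Column expansion of the domain wall partition function -/

section DomainWall

/-- Exactly the n − i pairs i < k have to be turned round, and n − i has the parity of n + i. -/
theorem prod_lt_succAbove {n : ℕ} (i : Fin (n + 1)) (G : Fin (n + 1) → Fin (n + 1) → ℂ)
    (hG : ∀ j k, G j k = -G k j) :
    ∏ j, ∏ k with j < k, G j k = (-1) ^ (n + (i : ℕ)) * (∏ l, G (i.succAbove l) i) *
      ∏ j, ∏ k with j < k, G (i.succAbove j) (i.succAbove k) := by
  simp only [prod_filter]
  rw [Fin.prod_univ_succAbove _ i, Fin.prod_univ_succAbove _ i]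
  simp only [fun j => Fin.prod_univ_succAbove (fun k => if i.succAbove j < k then
    G (i.succAbove j) k else 1) i, prod_mul_distrib, lt_self_iff_false, if_false, one_mul,
    Fin.succAbove_lt_succAbove_iff]
  rw [← mul_assoc]
  congr 1
  have hsign : ∏ l : Fin n, (if i < i.succAbove l then (-1 : ℂ) else 1) = (-1) ^ (n + (i : ℕ)) := by
    have h1 : ∏ k : Fin (n + 1), (if i < k then (-1 : ℂ) else 1) = (-1) ^ (n - (i : ℕ)) := by
      rw [← prod_filter, prod_const, show (univ.filter fun k => i < k) = Ioi i by ext; simp, Fin.card_Ioi]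
      simp
    rw [Fin.prod_univ_succAbove _ i] at h1
    simp only [lt_self_iff_false, if_false, one_mul] at h1
    rw [h1]
    have : n + (i : ℕ) = (n - i) + 2 * i := by omega
    rw [this, pow_add, pow_mul]; simp
  rw [← hsign, ← prod_mul_distrib, ← prod_mul_distrib]
  refine prod_congr rfl fun l _ => ?_
  rcases lt_or_gt_of_ne (Fin.succAbove_ne i l) with hlt | hlt
  · simp [hlt, hlt.not_gt]
  · simp [hlt, hlt.not_gt, hG i]

/-- The cofactor expansion of the domain wall partition function, with the variable `u p` in the
cofactors' complement replaced by `z` and the common factor removed. -/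
def columnExpansion (c : ℂ) {n : ℕ} (v u : Fin (n + 1) → ℂ) (p : Fin (n + 1)) (z : ℂ) : ℂ :=
  ∑ j, (∏ l, g c (v (j.succAbove l)) (v j)) * (∏ k, h c (v j) (u (p.succAbove k))) *
    (∏ l, h c (v (j.succAbove l)) z) * g c (v j) z *
      dwpf c (v ∘ j.succAbove) (u ∘ p.succAbove)

/-- Laplace expansion along column p. Each minor, with the part of the prefactor free of row j and
column p, is again a partition function, and the cofactor signs cancel against those from reordering
the antisymmetric g's. Letting z vary in this column makes the expansion a function of z to which
residues apply. -/
theorem columnExpansion_eq (c : ℂ) {n : ℕ} (v u : Fin (n + 1) → ℂ) (p : Fin (n + 1)) (z : ℂ)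
    (hz : ∀ j, h c (v j) z ≠ 0) :
    columnExpansion c v u p z = (-1) ^ (n + (p : ℕ)) * (∏ j, ∏ k with j < k, g c (v j) (v k)) *
      (∏ j, ∏ k with k < j, g c (u (p.succAbove j)) (u (p.succAbove k))) *
      (∏ j, (h c (v j) z * ∏ k, h c (v j) (u (p.succAbove k)))) *
      Matrix.det (Matrix.of fun j k => g c (v j) (Function.update u p z k) /
        h c (v j) (Function.update u p z k)) := by
  rw [Matrix.det_succ_column _ p, mul_sum, columnExpansion]
  refine sum_congr rfl fun j _ => ?_
  rw [prod_lt_succAbove j (fun i k => g c (v i) (v k)) fun i k => g_swap _ _,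
    Fin.prod_univ_succAbove _ j, dwpf]
  simp only [prod_mul_distrib, Matrix.of_apply, Function.update_self, Function.comp_apply]
  have hm : ((Matrix.of fun j k => g c (v j) (Function.update u p z k) /
        h c (v j) (Function.update u p z k)).submatrix j.succAbove p.succAbove).det
      = (Matrix.of fun i k => g c (v (j.succAbove i)) (u (p.succAbove k)) /
        h c (v (j.succAbove i)) (u (p.succAbove k))).det := by
    congr 1
    ext i k
    simp
  rw [hm]
  have hs : (-1 : ℂ) ^ (n + (p : ℕ)) * (-1) ^ (n + (j : ℕ)) * (-1) ^ ((j : ℕ) + (p : ℕ)) = 1 := by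
    rw [← pow_add, ← pow_add]
    exact Even.neg_one_pow ⟨n + p + j, by ring⟩
  field_simp [hz j]
  linear_combination (-(∏ l, g c (v (j.succAbove l)) (v j)) *
    (∏ k, h c (v j) (u (p.succAbove k))) * (∏ l, h c (v (j.succAbove l)) z) * g c (v j) z *
    ((∏ i, ∏ k with i < k, g c (v (j.succAbove i)) (v (j.succAbove k))) *
      (∏ i, ∏ k with k < i, g c (u (p.succAbove i)) (u (p.succAbove k))) *
      (∏ i, ∏ k, h c (v (j.succAbove i)) (u (p.succAbove k))) *
      (Matrix.of fun i k => g c (v (j.succAbove i)) (u (p.succAbove k)) /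
        h c (v (j.succAbove i)) (u (p.succAbove k))).det)) * hs

theorem dwpf_eq_columnExpansion (c : ℂ) {n : ℕ} (v u : Fin (n + 1) → ℂ) (p : Fin (n + 1))
    (hz : ∀ j, h c (v j) (u p) ≠ 0) :
    dwpf c v u = (∏ k, g c (u p) (u (p.succAbove k))) * columnExpansion c v u p (u p) := by
  have hy : (∏ j, ∏ k with k < j, g c (u j) (u k)) = (-1) ^ (n + (p : ℕ)) *
      (∏ k, g c (u p) (u (p.succAbove k))) *
      ∏ j, ∏ k with k < j, g c (u (p.succAbove j)) (u (p.succAbove k)) := by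
    have e : ∀ {m : ℕ} (G : Fin m → Fin m → ℂ),
        (∏ j, ∏ k with k < j, G j k) = ∏ j, ∏ k with j < k, G k j := by
      intro m G
      simp only [prod_filter]
      exact prod_comm
    rw [e, e, prod_lt_succAbove p (fun i k => g c (u k) (u i)) fun i k => g_swap _ _]
  rw [columnExpansion_eq c v u p _ hz, Function.update_eq_self, dwpf, hy]
  have : (∏ j, ∏ k, h c (v j) (u k))
      = ∏ j, (h c (v j) (u p) * ∏ k, h c (v j) (u (p.succAbove k))) :=
    prod_congr rfl fun j _ => Fin.prod_univ_succAbove _ p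
  rw [this]
  ring

/-- Two columns of the determinant coincide. In `dwpfOn_insert` this kills the residues at α. -/
theorem columnExpansion_eq_zero (c : ℂ) {n : ℕ} (v u : Fin (n + 1) → ℂ) (p : Fin (n + 1))
    (k : Fin n) (hz : ∀ j, h c (v j) (u (p.succAbove k)) ≠ 0) :
    columnExpansion c v u p (u (p.succAbove k)) = 0 := by
  rw [columnExpansion_eq c v u p _ hz, Matrix.det_zero_of_column_eq (Fin.succAbove_ne p k).symm,
    mul_zero]
  intro i
  simp

end DomainWall

/-! ### Reduction of K by one pair of variables, for subsets -/

section DomainWallFinset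

/-- The domain wall partition function `K(x̄_β | ȳ_α)` of the subsets indexed by `β` and `α`, in
their natural order; zero if the two sets have different sizes. -/
def dwpfOn {ι κ : Type*} [LinearOrder ι] [LinearOrder κ] (c : ℂ) (x : ι → ℂ) (y : κ → ℂ)
    (β : Finset ι) (α : Finset κ) : ℂ :=
  if hcard : #β = #α then
    dwpf c (fun i => x (β.orderEmbOfFin hcard i)) fun i => y (α.orderEmbOfFin rfl i)
  else 0

theorem dwpfOn_eq {ι κ : Type*} [LinearOrder ι] [LinearOrder κ] (c : ℂ) (x : ι → ℂ) (y : κ → ℂ)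
    {β : Finset ι} {α : Finset κ} {n : ℕ} (hβ : #β = n) (hα : #α = n) :
    dwpfOn c x y β α
      = dwpf c (fun i => x (β.orderEmbOfFin hβ i)) fun i => y (α.orderEmbOfFin hα i) := by
  subst hα
  rw [dwpfOn, dif_pos hβ]

theorem dwpfOn_of_card_ne {ι κ : Type*} [LinearOrder ι] [LinearOrder κ] (c : ℂ) (x : ι → ℂ)
    (y : κ → ℂ) {β : Finset ι} {α : Finset κ} (hne : #β ≠ #α) : dwpfOn c x y β α = 0 :=
  dif_neg hne

variable {ι : Type*} [LinearOrder ι]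

theorem erase_orderEmbOfFin {s : Finset ι} {n : ℕ} (hs : #s = n + 1) (i : Fin (n + 1)) :
    s.erase (s.orderEmbOfFin hs i)
      = univ.map (i.succAboveEmb.trans (s.orderEmbOfFin hs).toEmbedding) := by
  ext k
  simp only [mem_erase, mem_map, mem_univ, true_and, Function.Embedding.trans_apply,
    Fin.coe_succAboveEmb, RelEmbedding.coe_toEmbedding]
  constructor
  · rintro ⟨hne, hk⟩
    have hk' : k ∈ Set.range (s.orderEmbOfFin hs) := by simpa using hk
    obtain ⟨m, rfl⟩ := hk'
    obtain ⟨l, rfl⟩ := Fin.exists_succAbove_eq (fun hh => hne (congrArg _ hh) : m ≠ i)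
    exact ⟨l, rfl⟩
  · rintro ⟨l, rfl⟩
    exact ⟨fun hh => Fin.succAbove_ne i l ((s.orderEmbOfFin hs).injective hh),
      orderEmbOfFin_mem _ _ _⟩

theorem prod_erase_orderEmbOfFin {s : Finset ι} {n : ℕ} (hs : #s = n + 1) (i : Fin (n + 1))
    (F : ι → ℂ) :
    ∏ l ∈ s.erase (s.orderEmbOfFin hs i), F l
      = ∏ l, F (s.orderEmbOfFin hs (i.succAbove l)) := by
  rw [erase_orderEmbOfFin hs i, prod_map]
  rfl

theorem card_erase_orderEmbOfFin {s : Finset ι} {n : ℕ} (hs : #s = n + 1) (i : Fin (n + 1)) :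
    #(s.erase (s.orderEmbOfFin hs i)) = n := by
  rw [erase_orderEmbOfFin hs i, card_map, card_univ, Fintype.card_fin]

theorem orderEmbOfFin_erase {s : Finset ι} {n : ℕ} (hs : #s = n + 1) (i : Fin (n + 1)) :
    ⇑((s.erase (s.orderEmbOfFin hs i)).orderEmbOfFin (card_erase_orderEmbOfFin hs i))
      = s.orderEmbOfFin hs ∘ i.succAbove := by
  symm
  apply orderEmbOfFin_unique
  · intro l
    exact mem_erase.mpr ⟨fun hh => Fin.succAbove_ne i l ((s.orderEmbOfFin hs).injective hh),
      orderEmbOfFin_mem _ _ _⟩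
  · exact (s.orderEmbOfFin hs).strictMono.comp (Fin.strictMono_succAbove i)

variable {c : ℂ} {x : ι → ℂ}

theorem sum_columnExpansion {α β : Finset ι} {n : ℕ} (hβ : #β = n + 1) (hα : #α = n + 1)
    (p : Fin (n + 1)) (z : ℂ) :
    ∑ j ∈ β, (∏ l ∈ β.erase j, g c (x l) (x j)) *
        (∏ k ∈ α.erase (α.orderEmbOfFin hα p), h c (x j) (x k)) *
        (∏ l ∈ β.erase j, h c (x l) z) * g c (x j) z *
        dwpfOn c x x (β.erase j) (α.erase (α.orderEmbOfFin hα p))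
      = columnExpansion c (fun i => x (β.orderEmbOfFin hβ i))
          (fun i => x (α.orderEmbOfFin hα i)) p z := by
  conv_lhs => rw [← map_orderEmbOfFin_univ β hβ]
  rw [sum_map, columnExpansion]
  refine sum_congr rfl fun j _ => ?_
  simp only [map_orderEmbOfFin_univ, RelEmbedding.coe_toEmbedding]
  rw [prod_erase_orderEmbOfFin hβ, prod_erase_orderEmbOfFin hα, prod_erase_orderEmbOfFin hβ,
    dwpfOn_eq c x x (card_erase_orderEmbOfFin hβ j) (card_erase_orderEmbOfFin hα p),
    orderEmbOfFin_erase, orderEmbOfFin_erase]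
  rfl

theorem exists_orderEmbOfFin_eq {s : Finset ι} {n : ℕ} (hs : #s = n) {k : ι} (hk : k ∈ s) :
    ∃ p, s.orderEmbOfFin hs p = k := by
  have : k ∈ Set.range (s.orderEmbOfFin hs) := by simpa using hk
  exact this

theorem dwpfOn_insert_eq_sum_columns {α β : Finset ι} {o : ι} (ho : o ∉ α) (hcard : #β = #α + 1)
    (hh : ∀ j ∈ β, h c (x j) (x o) ≠ 0) :
    dwpfOn c x x β (insert o α) = (∏ k ∈ α, g c (x o) (x k)) *
      ∑ j ∈ β, (∏ l ∈ β.erase j, g c (x l) (x j)) * (∏ k ∈ α, h c (x j) (x k)) *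
        (∏ l ∈ β.erase j, h c (x l) (x o)) * g c (x j) (x o) * dwpfOn c x x (β.erase j) α := by
  have hα : #(insert o α) = #α + 1 := card_insert_of_notMem ho
  obtain ⟨p, hp⟩ := exists_orderEmbOfFin_eq hα (mem_insert_self o α)
  have he : (insert o α).erase ((insert o α).orderEmbOfFin hα p) = α := by
    rw [hp, erase_insert ho]
  have hS := sum_columnExpansion (c := c) (x := x) hcard hα p (x o)
  rw [he] at hS
  rw [hS, dwpfOn_eq c x x hcard hα, dwpf_eq_columnExpansion c _ _ p]
  · have := prod_erase_orderEmbOfFin hα p fun k => g c (x o) (x k)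
    rw [he] at this
    rw [this, hp]
  · intro j
    rw [hp]
    exact hh _ (orderEmbOfFin_mem _ _ _)

theorem sum_columns_eq_zero {α β : Finset ι} {o k : ι} (ho : o ∉ α) (hcard : #β = #α + 1)
    (hk : k ∈ α) (hh : ∀ j ∈ β, h c (x j) (x k) ≠ 0) :
    ∑ j ∈ β, (∏ l ∈ β.erase j, g c (x l) (x j)) * (∏ k ∈ α, h c (x j) (x k)) *
        (∏ l ∈ β.erase j, h c (x l) (x k)) * g c (x j) (x k) * dwpfOn c x x (β.erase j) α
      = 0 := by
  have hα : #(insert o α) = #α + 1 := card_insert_of_notMem ho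
  obtain ⟨p, hp⟩ := exists_orderEmbOfFin_eq hα (mem_insert_self o α)
  have he : (insert o α).erase ((insert o α).orderEmbOfFin hα p) = α := by
    rw [hp, erase_insert ho]
  have hS := sum_columnExpansion (c := c) (x := x) hcard hα p (x k)
  rw [he] at hS
  rw [hS]
  obtain ⟨q, hq⟩ := exists_orderEmbOfFin_eq hα (mem_insert_of_mem hk)
  have hqp : q ≠ p := fun e => ho (by rw [← hp, ← e, hq]; exact hk)
  obtain ⟨l, rfl⟩ := Fin.exists_succAbove_eq hqp
  rw [← hq]
  refine columnExpansion_eq_zero c _ _ p l fun j => ?_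
  rw [hq]
  exact hh _ (orderEmbOfFin_mem _ _ _)

-- Regard the column of o as a function of its variable z and sum residues over the nodes o, α, β.
-- The node o yields K itself, the nodes in α yield nothing because two columns coincide, and the
-- node j ∈ β yields the j-th term of the reduction.
open Polynomial in
theorem dwpfOn_insert (hc : c ≠ 0) (hx : Function.Injective x) {α β : Finset ι} {o : ι}
    (ho : o ∉ α) (hoβ : o ∉ β) (hdisj : Disjoint α β)
    (hh : ∀ j ∈ β, ∀ k ∈ insert o α, h c (x j) (x k) ≠ 0) :
    dwpfOn c x x β (insert o α) = ∑ j ∈ β, g c (x j) (x o) * (∏ k ∈ α, f c (x j) (x k)) *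
      (∏ l ∈ β.erase j, f c (x l) (x j)) * dwpfOn c x x (β.erase j) α := by
  by_cases hcard : #β = #α + 1
  swap
  · rw [dwpfOn_of_card_ne _ _ _ (by rw [card_insert_of_notMem ho]; exact hcard), sum_eq_zero]
    intro j hj
    rw [dwpfOn_of_card_ne, mul_zero]
    have := card_pos.mpr ⟨j, hj⟩
    rw [card_erase_of_mem hj]
    omega
  set B : ι → ℂ := fun j => (∏ l ∈ β.erase j, g c (x l) (x j)) * (∏ k ∈ α, h c (x j) (x k)) *
    dwpfOn c x x (β.erase j) α with hB
  -- Up to a constant, the column expansion in the variable z, multiplied by ∏_β (z − x_j) to clear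
  -- its poles. Its degree is at most 2 #α, against 2 #α + 2 nodes.
  set Q : ℂ[X] := ∑ j ∈ β, C (B j) * ∏ l ∈ β.erase j, ((C (x l + c) - X) * (X - C (x l))) with hQ
  have hQeval : ∀ z, Q.eval z = ∑ j ∈ β, B j * ∏ l ∈ β.erase j, ((x l - z + c) * (z - x l)) := by
    intro z
    simp only [hQ, eval_finsetSum, eval_mul, eval_C, eval_prod, eval_sub, eval_X]
    exact sum_congr rfl fun j _ => by
      congr 1; exact prod_congr rfl fun l _ => by ring
  have hQdeg : Q.natDegree ≤ 2 * #α := by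
    refine natDegree_sum_le_of_forall_le _ _ fun j hj => ?_
    refine (natDegree_C_mul_le _ _).trans ((natDegree_prod_le _ _).trans ?_)
    have hcj : #(β.erase j) = #α := by rw [card_erase_of_mem hj, hcard]; rfl
    rw [← hcj, mul_comm, ← smul_eq_mul]
    refine sum_le_card_nsmul _ _ _ fun l _ => natDegree_mul_le.trans ?_
    rw [natDegree_X_sub_C]
    have : (C (x l + c) - X : ℂ[X]).natDegree ≤ 1 := by
      rw [← neg_sub, natDegree_neg, natDegree_X_sub_C]
    omega
  have hoS : o ∉ α ∪ β := by simp [ho, hoβ]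
  have hdeg : Q.natDegree + 1 < #(insert o (α ∪ β)) := by
    rw [card_insert_of_notMem hoS, card_union_of_disjoint hdisj, hcard]
    omega
  have H := sum_eval_div_prod_sub_eq_zero hx hdeg
  have hQz : ∀ z, (∀ j ∈ β, x j ≠ z) → Q.eval z = -(c ^ #α / c) * (∏ j ∈ β, (z - x j)) *
      ∑ j ∈ β, (∏ l ∈ β.erase j, g c (x l) (x j)) * (∏ k ∈ α, h c (x j) (x k)) *
        (∏ l ∈ β.erase j, h c (x l) z) * g c (x j) z * dwpfOn c x x (β.erase j) α := by
    intro z hz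
    rw [hQeval, mul_sum]
    refine sum_congr rfl fun j hj => ?_
    have hcj : #(β.erase j) = #α := by rw [card_erase_of_mem hj, hcard]; rfl
    have h1 : z - x j ≠ 0 := sub_ne_zero.mpr (hz j hj).symm
    have h2 : g c (x j) z = -(c / (z - x j)) := by rw [g, ← neg_sub, div_neg]
    have h3 : ∏ l ∈ β.erase j, h c (x l) z = (∏ l ∈ β.erase j, (x l - z + c)) / c ^ #α := by
      simp only [h, prod_div_distrib, prod_const, hcj]
    rw [h2, h3, ← mul_prod_erase β _ hj, prod_mul_distrib, hB]
    field_simp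
  rw [sum_insert hoS, sum_union hdisj, erase_insert hoS, prod_union hdisj] at H
  have eo : Q.eval (x o) / ((∏ k ∈ α, (x o - x k)) * ∏ k ∈ β, (x o - x k))
      = -(1 / c) * dwpfOn c x x β (insert o α) := by
    have n2 : ∏ k ∈ β, (x o - x k) ≠ 0 := prod_ne_zero_iff.mpr fun k hk =>
      sub_ne_zero.mpr (hx.ne fun e => hoβ (e ▸ hk))
    rw [dwpfOn_insert_eq_sum_columns ho hcard fun j hj => hh j hj o (mem_insert_self _ _),
      hQz (x o) fun j hj => hx.ne fun e => hoβ (e ▸ hj)]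
    simp only [g.eq_def c (x o), prod_div_distrib, prod_const]
    field_simp
  have ei : ∀ i ∈ α, Q.eval (x i) / ∏ k ∈ (insert o (α ∪ β)).erase i, (x i - x k) = 0 := by
    intro i hi
    rw [hQz (x i) fun j hj => hx.ne fun e => disjoint_right.mp hdisj hj (e ▸ hi),
      sum_columns_eq_zero ho hcard hi fun j hj => hh j hj i (mem_insert_of_mem hi),
      mul_zero, zero_div]
  have ej : ∀ j ∈ β, Q.eval (x j) / ∏ k ∈ (insert o (α ∪ β)).erase j, (x j - x k)
      = (1 / c) * (g c (x j) (x o) * (∏ k ∈ α, f c (x j) (x k)) *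
          (∏ l ∈ β.erase j, f c (x l) (x j)) * dwpfOn c x x (β.erase j) α) := by
    intro j hj
    have hjα : j ∉ α := disjoint_right.mp hdisj hj
    have hjo : j ≠ o := fun e => hoβ (e ▸ hj)
    have n1 : ∏ k ∈ β.erase j, (x j - x k) ≠ 0 := prod_ne_zero_iff.mpr fun k hk =>
      sub_ne_zero.mpr (hx.ne (ne_of_mem_erase hk).symm)
    have n2 : ∏ k ∈ α, (x j - x k) ≠ 0 := prod_ne_zero_iff.mpr fun k hk =>
      sub_ne_zero.mpr (hx.ne fun e => hjα (e ▸ hk))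
    have n3 : x j - x o ≠ 0 := sub_ne_zero.mpr (hx.ne hjo)
    have hS : (insert o (α ∪ β)).erase j = insert o (α ∪ β.erase j) := by
      rw [erase_insert_of_ne hjo.symm, erase_union_distrib, erase_eq_of_notMem hjα]
    have hcj : #(β.erase j) = #α := by rw [card_erase_of_mem hj, hcard]; rfl
    -- Every summand other than the j-th contains the factor z − x_j.
    have hQj : Q.eval (x j) = B j * ∏ l ∈ β.erase j, ((x l - x j + c) * (x j - x l)) := by
      rw [hQeval, sum_eq_single_of_mem j hj]
      intro i _ hij
      rw [prod_eq_zero (mem_erase.mpr ⟨hij.symm, hj⟩) (by simp), mul_zero]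
    have q1 : ∏ k ∈ α, f c (x j) (x k)
        = (c ^ #α / ∏ k ∈ α, (x j - x k)) * ∏ k ∈ α, h c (x j) (x k) := by
      rw [← prod_const, ← prod_div_distrib, ← prod_mul_distrib]
      exact prod_congr rfl fun k _ => f_eq_g_mul_h hc _ _
    have q2 : ∏ l ∈ β.erase j, f c (x l) (x j)
        = (∏ l ∈ β.erase j, g c (x l) (x j)) * ((∏ l ∈ β.erase j, (x l - x j + c)) / c ^ #α) := by
      rw [← hcj, ← prod_const, ← prod_div_distrib, ← prod_mul_distrib]
      exact prod_congr rfl fun k _ => f_eq_g_mul_h hc _ _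
    rw [hQj, hS, prod_insert (by simp [ho, hoβ]),
      prod_union (hdisj.mono_right (erase_subset _ _)), q1, q2, g, prod_mul_distrib]
    simp only [hB]
    field_simp
  rw [eo, sum_congr rfl ei, sum_congr rfl ej, ← mul_sum, sum_const_zero, zero_add] at H
  have hc' : (1 / c) ≠ 0 := one_div_ne_zero hc
  refine mul_left_cancel₀ hc' ?_
  linear_combination -H

end DomainWallFinset

/-! ### Bookkeeping for sums over subsets and double products -/

section Reindexing

variable {ι M : Type*} [DecidableEq ι] [AddCommMonoid M]

/-- An exchange term for i ∈ α leaves a monomial indexed by α∖i; this regroups such terms by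
monomial. -/
theorem sum_powerset_sum_erase (U : Finset ι) (F : Finset ι → ι → M) :
    ∑ α ∈ U.powerset, ∑ i ∈ α, F (α.erase i) i = ∑ α ∈ U.powerset, ∑ i ∈ U \ α, F α i := by
  rw [sum_sigma', sum_sigma']
  refine sum_bij' (fun p _ => ⟨p.1.erase p.2, p.2⟩) (fun p _ => ⟨insert p.2 p.1, p.2⟩)
    ?_ ?_ ?_ ?_ ?_
  · rintro ⟨α, i⟩ hp
    simp only [mem_sigma, mem_powerset, mem_sdiff] at hp ⊢
    exact ⟨(erase_subset _ _).trans hp.1, hp.1 hp.2, notMem_erase _ _⟩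
  · rintro ⟨α, i⟩ hp
    simp only [mem_sigma, mem_powerset, mem_sdiff] at hp ⊢
    exact ⟨insert_subset hp.2.1 hp.1, mem_insert_self _ _⟩
  · rintro ⟨α, i⟩ hp
    simp only [mem_sigma] at hp
    simp [insert_erase hp.2]
  · rintro ⟨α, i⟩ hp
    simp only [mem_sigma, mem_sdiff] at hp
    simp [erase_insert hp.2.2]
  · intros; rfl

theorem sum_sum_powerset_erase (V : Finset ι) (F : Finset ι → ι → M) :
    ∑ j ∈ V, ∑ β ∈ (V.erase j).powerset, F β j = ∑ β ∈ V.powerset, ∑ j ∈ β, F (β.erase j) j := by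
  rw [sum_powerset_sum_erase]
  refine sum_comm' fun j β => ?_
  simp only [mem_powerset, mem_sdiff, subset_erase]
  tauto

end Reindexing

section DoubleProducts

variable {ι κ : Type*} (φ : ℂ → ℂ → ℂ) (x : ι → ℂ) (y : κ → ℂ)

theorem prod₂_insert_left [DecidableEq ι] {i : ι} {s : Finset ι} (hi : i ∉ s) (t : Finset κ) :
    prod₂ φ x (insert i s) y t = (∏ j ∈ t, φ (x i) (y j)) * prod₂ φ x s y t := by
  rw [prod₂, prod_insert hi, prod₂]

theorem prod₂_insert_right [DecidableEq κ] (s : Finset ι) {j : κ} {t : Finset κ} (hj : j ∉ t) :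
    prod₂ φ x s y (insert j t) = (∏ i ∈ s, φ (x i) (y j)) * prod₂ φ x s y t := by
  rw [prod₂, prod₂, ← prod_mul_distrib]
  exact prod_congr rfl fun i _ => prod_insert hj

theorem prod₂_erase_left [DecidableEq ι] {i : ι} {s : Finset ι} (hi : i ∈ s) (t : Finset κ) :
    (∏ j ∈ t, φ (x i) (y j)) * prod₂ φ x (s.erase i) y t = prod₂ φ x s y t := by
  conv_rhs => rw [← insert_erase hi]
  rw [prod₂_insert_left φ x y (notMem_erase _ _)]

theorem prod₂_erase_right [DecidableEq κ] (s : Finset ι) {j : κ} {t : Finset κ} (hj : j ∈ t) :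
    (∏ i ∈ s, φ (x i) (y j)) * prod₂ φ x s y (t.erase j) = prod₂ φ x s y t := by
  conv_rhs => rw [← insert_erase hj]
  rw [prod₂_insert_right φ x y s (notMem_erase _ _)]

end DoubleProducts

/-! ### Scalar identities behind the two recursions -/

section Coefficients

variable {ι : Type*} [LinearOrder ι] {c : ℂ} {x : ι → ℂ}

/-- `g(x̄_β, x̄_α)` if the two sets have the same size, and zero otherwise. -/
def gOn {ι κ : Type*} (c : ℂ) (x : ι → ℂ) (y : κ → ℂ) (β : Finset ι) (α : Finset κ) : ℂ :=
  if #β = #α then prod₂ (g c) x β y α else 0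

theorem sdiff_insert_eq_erase (U s : Finset ι) (i : ι) :
    U \ insert i s = (U \ s).erase i := by
  ext k; simp only [mem_sdiff, mem_insert, mem_erase]; tauto

/-- Both sides are the coefficient of one monomial of `sumX_insert`. On the left are the subset o∪α
and the exchange terms of the subsets i∪α; on the right is the recursion. After the common factor
g(β, α) f(α, U∖α) is removed, this is `sum_residues` with γ = U∖α. -/
theorem gOn_recursion (hc : c ≠ 0) (hx : Function.Injective x) {U α β : Finset ι} {o : ι}
    (hoU : o ∉ U) (hoβ : o ∉ β) (hUβ : Disjoint U β) (hα : α ⊆ U) :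
    gOn c x x β (insert o α) * prod₂ (f c) x (insert o α) x (U \ α) * (∏ k ∈ α, h c (x o) (x k))
      + ∑ i ∈ U \ α, gOn c x x β (insert i α) * prod₂ (f c) x (insert i α) x (U \ insert i α) *
          (g c (x i) (x o) * (∏ k ∈ α, h c (x i) (x k)) * ∏ k ∈ α, f c (x k) (x i))
      = ∑ j ∈ β, g c (x j) (x o) * (∏ k ∈ U, f c (x j) (x k)) *
          (∏ k ∈ β.erase j, g c (x k) (x j)) * (gOn c x x (β.erase j) α *
            prod₂ (f c) x α x (U \ α)) := by
  have hoα : o ∉ α := fun e => hoU (hα e)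
  by_cases hcard : #β = #α + 1
  swap
  · have e0 : ∀ i, i ∉ α → gOn c x x β (insert i α) = 0 := fun i hi =>
      if_neg (by rw [card_insert_of_notMem hi]; exact hcard)
    rw [e0 o hoα, sum_eq_zero, sum_eq_zero]
    · ring
    · intro j hj
      have := card_pos.mpr ⟨j, hj⟩
      rw [gOn, if_neg]
      · ring
      · rw [card_erase_of_mem hj]; omega
    · intro i hi
      rw [e0 i (mem_sdiff.mp hi).2]
      ring
  have e1 : ∀ i, i ∉ α → gOn c x x β (insert i α)
      = (∏ k ∈ β, g c (x k) (x i)) * prod₂ (g c) x β x α := fun i hi => by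
    rw [gOn, if_pos (by rw [card_insert_of_notMem hi]; exact hcard), prod₂_insert_right _ _ _ _ hi]
  have H := sum_residues hc hx (α := α) (β := β) (γ := U \ α) (o := o) hoβ
    (fun e => hoU (mem_sdiff.mp e).1) (hUβ.mono_left sdiff_subset) hcard
  have eR : ∀ j ∈ β, g c (x j) (x o) * (∏ k ∈ U, f c (x j) (x k)) *
          (∏ k ∈ β.erase j, g c (x k) (x j)) * (gOn c x x (β.erase j) α *
            prod₂ (f c) x α x (U \ α))
      = prod₂ (g c) x β x α * prod₂ (f c) x α x (U \ α) * (g c (x j) (x o) *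
        (∏ i ∈ U \ α, f c (x j) (x i)) * (∏ k ∈ α, h c (x j) (x k)) *
          ∏ k ∈ β.erase j, g c (x k) (x j)) := by
    intro j hj
    have hcj : #(β.erase j) = #α := by rw [card_erase_of_mem hj, hcard]; rfl
    have q1 : ∏ k ∈ α, f c (x j) (x k) = (∏ k ∈ α, g c (x j) (x k)) * ∏ k ∈ α, h c (x j) (x k) := by
      rw [← prod_mul_distrib]
      exact prod_congr rfl fun k _ => f_eq_g_mul_h hc _ _
    rw [gOn, if_pos hcj, ← prod_sdiff hα, q1, ← prod₂_erase_left _ _ _ hj]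
    ring
  have eL : ∀ i ∈ U \ α, gOn c x x β (insert i α) *
        prod₂ (f c) x (insert i α) x (U \ insert i α) *
          (g c (x i) (x o) * (∏ k ∈ α, h c (x i) (x k)) * ∏ k ∈ α, f c (x k) (x i))
      = prod₂ (g c) x β x α * prod₂ (f c) x α x (U \ α) * (g c (x i) (x o) *
        (∏ k ∈ β, g c (x k) (x i)) * (∏ k ∈ (U \ α).erase i, f c (x i) (x k)) *
          (∏ k ∈ α, h c (x i) (x k))) := by
    intro i hi
    rw [e1 i (mem_sdiff.mp hi).2, sdiff_insert_eq_erase,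
      prod₂_insert_left _ _ _ (mem_sdiff.mp hi).2, ← prod₂_erase_right (f c) x x α hi]
    ring
  rw [sum_congr rfl eR, sum_congr rfl eL, ← mul_sum, ← mul_sum, ← H, e1 o hoα,
    prod₂_insert_left _ _ _ hoα]
  ring

/-- The analogue for `sumY_insert`. Reducing every K by `dwpfOn_insert` and interchanging the sums,
the identity holds separately for each j ∈ β, by `sum_residues_left` with p = j. -/
theorem dwpfOn_recursion (hc : c ≠ 0) (hx : Function.Injective x) {U α β : Finset ι} {o : ι}
    (hoU : o ∉ U) (hoβ : o ∉ β) (hUβ : Disjoint U β) (hα : α ⊆ U)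
    (hh : ∀ j ∈ β, ∀ k ∈ insert o U, h c (x j) (x k) ≠ 0) :
    dwpfOn c x x β (insert o α) * prod₂ (f c) x (insert o α) x (U \ α)
      + ∑ i ∈ U \ α, dwpfOn c x x β (insert i α) * prod₂ (f c) x (insert i α) x (U \ insert i α) *
          (g c (x i) (x o) * ∏ k ∈ α, f c (x k) (x i))
      = ∑ j ∈ β, g c (x j) (x o) * (∏ k ∈ U, f c (x j) (x k)) *
          (∏ k ∈ β.erase j, f c (x k) (x j)) * (dwpfOn c x x (β.erase j) α *
            prod₂ (f c) x α x (U \ α)) := by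
  have hoα : o ∉ α := fun e => hoU (hα e)
  have e1 : ∀ i ∈ insert o (U \ α), dwpfOn c x x β (insert i α)
      = ∑ j ∈ β, g c (x j) (x i) * (∏ k ∈ α, f c (x j) (x k)) *
      (∏ l ∈ β.erase j, f c (x l) (x j)) * dwpfOn c x x (β.erase j) α := by
    intro i hi
    have hi' : i ∈ insert o U := insert_subset_insert _ sdiff_subset hi
    have hiβ : i ∉ β := by
      rcases mem_insert.mp hi with rfl | hi
      · exact hoβ
      · exact disjoint_left.mp hUβ (mem_sdiff.mp hi).1
    have hiα : i ∉ α := by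
      rcases mem_insert.mp hi with rfl | hi
      · exact hoα
      · exact (mem_sdiff.mp hi).2
    exact dwpfOn_insert hc hx hiα hiβ (hUβ.mono_left hα) fun j hj k hk =>
      hh j hj k (insert_subset hi' (hα.trans (subset_insert _ _)) hk)
  have eL : ∀ i ∈ U \ α, dwpfOn c x x β (insert i α) *
        prod₂ (f c) x (insert i α) x (U \ insert i α) *
          (g c (x i) (x o) * ∏ k ∈ α, f c (x k) (x i))
      = ∑ j ∈ β, (∏ k ∈ α, f c (x j) (x k)) * (∏ l ∈ β.erase j, f c (x l) (x j)) *
        dwpfOn c x x (β.erase j) α * prod₂ (f c) x α x (U \ α) *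
        (g c (x i) (x o) * g c (x j) (x i) * ∏ k ∈ (U \ α).erase i, f c (x i) (x k)) := by
    intro i hi
    rw [e1 i (mem_insert_of_mem hi), sdiff_insert_eq_erase,
      prod₂_insert_left _ _ _ (mem_sdiff.mp hi).2, ← prod₂_erase_right (f c) x x α hi, sum_mul,
      sum_mul]
    exact sum_congr rfl fun j _ => by ring
  rw [sum_congr rfl eL, sum_comm, e1 o (mem_insert_self _ _), sum_mul, ← sum_add_distrib]
  refine sum_congr rfl fun j hj => ?_
  have hjU : j ∉ U := disjoint_right.mp hUβ hj
  have H := sum_residues_left hc hx (γ := U \ α) (o := o) (p := j) (fun e => hoβ (e ▸ hj))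
    (fun e => hoU (mem_sdiff.mp e).1) (fun e => hjU (mem_sdiff.mp e).1)
  rw [← mul_sum, prod₂_insert_left _ _ _ hoα, ← prod_sdiff hα]
  linear_combination ((∏ k ∈ α, f c (x j) (x k)) * (∏ l ∈ β.erase j, f c (x l) (x j)) *
        dwpfOn c x x (β.erase j) α * prod₂ (f c) x α x (U \ α)) * H

theorem erase_sdiff_erase_of_mem (V : Finset ι) {β : Finset ι} {j : ι} (hj : j ∈ β) :
    V.erase j \ β.erase j = V \ β := by
  ext k; simp only [mem_sdiff, mem_erase]
  constructor
  · rintro ⟨⟨h1, h2⟩, h3⟩; exact ⟨h2, fun h4 => h3 ⟨h1, h4⟩⟩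
  · rintro ⟨h1, h2⟩; exact ⟨⟨fun e => h2 (e ▸ hj), h1⟩, fun h3 => h2 h3.2⟩

theorem prod₂_sdiff_erase {V β : Finset ι} (φ : ℂ → ℂ → ℂ) (hβ : β ⊆ V) {j : ι} (hj : j ∈ β) :
    (∏ k ∈ V.erase j, φ (x k) (x j)) * prod₂ φ x (V.erase j \ β.erase j) x (β.erase j)
      = (∏ k ∈ β.erase j, φ (x k) (x j)) * prod₂ φ x (V \ β) x β := by
  have e := erase_sdiff_erase_of_mem V hj
  rw [e, ← prod_sdiff (erase_subset_erase j hβ), e, ← prod₂_erase_right φ x x (V \ β) hj]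
  ring

end Coefficients

/-- The commutation relations among `a i = T₁₂(x i)`, `d i = T₂₂(x i)`, `s i = T₂₃(x i)` and
`t i = T₁₃(x i)`. -/
structure IsExchangeFamily {ι A : Type*} [Ring A] [Algebra ℂ A] (c : ℂ) (x : ι → ℂ)
    (a d s t : ι → A) : Prop where
  aa : ∀ i j, a i * a j = a j * a i
  dd : ∀ i j, d i * d j = d j * d i
  ss : ∀ i j, i ≠ j → h c (x i) (x j) • (s i * s j) = h c (x j) (x i) • (s j * s i)
  tt : ∀ i j, i ≠ j → h c (x i) (x j) • (t i * t j) = h c (x j) (x i) • (t j * t i)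
  at_ : ∀ i j, i ≠ j →
    a i * t j = f c (x j) (x i) • (t j * a i) - g c (x j) (x i) • (t i * a j)
  da : ∀ i j, i ≠ j →
    d i * a j = f c (x i) (x j) • (a j * d i) - g c (x i) (x j) • (a i * d j)
  ds : ∀ i j, i ≠ j →
    d i * s j = f c (x j) (x i) • (s j * d i) - g c (x j) (x i) • (s i * d j)
  as : ∀ i j, i ≠ j → a i * s j - s j * a i = g c (x j) (x i) • (t j * d i - t i * d j)
  st : ∀ i j, i ≠ j →
    s i * t j = -(f c (x j) (x i) • (t j * s i)) - g c (x i) (x j) • (t i * s j)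

/-! ### Symmetric products of the operators -/

section Products

variable {ι A : Type*} [LinearOrder ι] [Ring A] [Algebra ℂ A]

/-- The symmetric product of the `t i`, normalised by the factors `h(x_m, x_l)`, `m < l`. -/
def mulH (c : ℂ) (x : ι → ℂ) (t : ι → A) (S : Finset ι) : A :=
  wprod (fun i j => h c (x i) (x j)) t S

/-- The symmetric product of the `t i`, divided by the factors `h(x_l, x_m)`, `m < l`. -/
def divH (c : ℂ) (x : ι → ℂ) (t : ι → A) (S : Finset ι) : A :=
  wprod (fun i j => (h c (x j) (x i))⁻¹) t S

variable {c : ℂ} {x : ι → ℂ} {t : ι → A}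

theorem mulH_insert (htt : ∀ i j, i ≠ j → h c (x i) (x j) • (t i * t j)
      = h c (x j) (x i) • (t j * t i)) {S : Finset ι} {i : ι} (hi : i ∉ S) :
    mulH c x t (insert i S) = (∏ j ∈ S, h c (x i) (x j)) • (t i * mulH c x t S) :=
  wprod_insert_left hi fun j _ k _ hjk => htt j k hjk

theorem inv_h_smul_mul {ι : Type*} {x : ι → ℂ} {t : ι → A} {i j : ι} (htt : h c (x i) (x j) • (t i * t j)
      = h c (x j) (x i) • (t j * t i)) (hij : h c (x i) (x j) ≠ 0) (hji : h c (x j) (x i) ≠ 0) :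
    (h c (x j) (x i))⁻¹ • (t i * t j) = (h c (x i) (x j))⁻¹ • (t j * t i) := by
  rw [inv_smul_eq_iff₀ hji, smul_comm, ← htt, inv_smul_smul₀ hij]

theorem mul_divH (htt : ∀ i j, i ≠ j → h c (x i) (x j) • (t i * t j)
      = h c (x j) (x i) • (t j * t i)) {S : Finset ι} {i : ι} (hi : i ∉ S)
    (hh : ∀ j ∈ insert i S, ∀ k ∈ insert i S, h c (x j) (x k) ≠ 0) :
    t i * divH c x t S = (∏ j ∈ S, h c (x j) (x i)) • divH c x t (insert i S) := by
  rw [divH, divH, wprod_insert_left hi fun j hj k hk hjk =>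
    inv_h_smul_mul (htt j k hjk) (hh j hj k hk) (hh k hk j hj), prod_inv_distrib, smul_inv_smul₀]
  exact prod_ne_zero_iff.mpr fun j hj => hh j (mem_insert_of_mem hj) i (mem_insert_self _ _)

theorem wprod_one_insert_left {a : ι → A} (haa : ∀ i j, a i * a j = a j * a i) {S : Finset ι}
    {i : ι} (hi : i ∉ S) : wprod 1 a (insert i S) = a i * wprod 1 a S := by
  rw [wprod_insert_left hi fun j _ k _ _ => by simp [haa j k]]
  simp

theorem wprod_one_insert_right {a : ι → A} (haa : ∀ i j, a i * a j = a j * a i) {S : Finset ι}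
    {i : ι} (hi : i ∉ S) : wprod 1 a (insert i S) = wprod 1 a S * a i := by
  rw [wprod_insert_right hi fun j _ k _ _ => by simp [haa j k]]
  simp

end Products

/-! ### Recursions of X and Y in the set U -/

section Recursions

variable {ι A : Type*} [LinearOrder ι] [Ring A] [Algebra ℂ A]

/-- `X(x̄_U, x̄_V)`, with the vanishing denominators cancelled. -/
def sumX (c : ℂ) (x : ι → ℂ) (a d s t : ι → A) (U V : Finset ι) : A :=
  ∑ α ∈ U.powerset, ∑ β ∈ V.powerset,
    (gOn c x x β α * prod₂ (f c) x α x (U \ α) * prod₂ (g c) x (V \ β) x β) •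
      (mulH c x t α * wprod 1 a (U \ α) * divH c x s (V \ β) * wprod 1 d β)

/-- `Y(x̄_U, x̄_V)`. -/
def sumY (c : ℂ) (x : ι → ℂ) (a d s t : ι → A) (U V : Finset ι) : A :=
  ∑ α ∈ U.powerset, ∑ β ∈ V.powerset,
    (dwpfOn c x x β α * prod₂ (f c) x α x (U \ α) * prod₂ (g c) x (V \ β) x β) •
      (divH c x t β * divH c x s (V \ β) * wprod 1 a (U \ α) * wprod 1 d α)

/-- The coefficient `g(x_j, x_o) f(x_j, x̄_U) g(x̄_{V∖j}, x_j)` of the recursions in `U`. -/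
def recCoeff (c : ℂ) (x : ι → ℂ) (o : ι) (U V : Finset ι) (j : ι) : ℂ :=
  g c (x j) (x o) * (∏ k ∈ U, f c (x j) (x k)) * ∏ k ∈ V.erase j, g c (x k) (x j)

variable {c : ℂ} {x : ι → ℂ} {a d s t : ι → A}

/-- If o ∉ α, then `a o` is carried left through the t's: the direct term gives a_o X(U, V), and
every exchange term starts with `t o`, like the terms with o ∈ α. All of these are then multiples of
the monomials `W α β`, and `gOn_recursion` compares the coefficients. -/
theorem sumX_insert (hE : IsExchangeFamily c x a d s t) (hc : c ≠ 0) (hx : Function.Injective x)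
    {U V : Finset ι} {o : ι} (hoU : o ∉ U) (hoV : o ∉ V) (hUV : Disjoint U V) :
    sumX c x a d s t (insert o U) V = a o * sumX c x a d s t U V
      + ∑ j ∈ V, recCoeff c x o U V j • (t o * sumX c x a d s t U (V.erase j) * d j) := by
  set N : Finset ι → A := fun β => divH c x s (V \ β) * wprod 1 d β with hN
  set W : Finset ι → Finset ι → A :=
    fun α β => t o * mulH c x t α * wprod 1 a (U \ α) * N β with hW
  -- the terms with `o ∉ α`
  have h1 : ∀ α ∈ U.powerset, ∀ β ∈ V.powerset,
      (gOn c x x β α * prod₂ (f c) x α x (insert o U \ α) * prod₂ (g c) x (V \ β) x β) •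
        (mulH c x t α * wprod 1 a (insert o U \ α) * divH c x s (V \ β) * wprod 1 d β)
      = a o * ((gOn c x x β α * prod₂ (f c) x α x (U \ α) * prod₂ (g c) x (V \ β) x β) •
          (mulH c x t α * wprod 1 a (U \ α) * divH c x s (V \ β) * wprod 1 d β))
        + ∑ i ∈ α, (gOn c x x β (insert i (α.erase i)) *
            prod₂ (f c) x (insert i (α.erase i)) x (U \ insert i (α.erase i)) *
            (g c (x i) (x o) * (∏ k ∈ α.erase i, h c (x i) (x k)) *
              ∏ k ∈ α.erase i, f c (x k) (x i)) * prod₂ (g c) x (V \ β) x β) •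
            W (α.erase i) β := by
    intro α hα β hβ
    rw [mem_powerset] at hα
    have hoα : o ∉ α := fun e => hoU (hα e)
    have ho' : o ∉ U \ α := fun e => hoU (mem_sdiff.mp e).1
    rw [insert_sdiff_of_notMem _ hoα, prod₂_insert_right _ _ _ _ ho',
      wprod_one_insert_left hE.aa ho']
    have hm := mul_wprod hc hx (w := fun i j => h c (x i) (x j)) hE.at_ hE.tt (α := α)
      (fun i _ j _ hij => hE.tt i j hij) (fun i _ j _ _ => mul_comm _ _) hoα
    change a o * mulH c x t α = _ • (mulH c x t α * a o) - _ at hm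
    have e1 : ∀ i ∈ α, (gOn c x x β (insert i (α.erase i)) *
            prod₂ (f c) x (insert i (α.erase i)) x (U \ insert i (α.erase i)) *
            (g c (x i) (x o) * (∏ k ∈ α.erase i, h c (x i) (x k)) *
              ∏ k ∈ α.erase i, f c (x k) (x i)) * prod₂ (g c) x (V \ β) x β) •
            W (α.erase i) β
        = (gOn c x x β α * prod₂ (f c) x α x (U \ α) * prod₂ (g c) x (V \ β) x β) •
          (((g c (x i) (x o) * (∏ k ∈ α.erase i, h c (x i) (x k)) *
              ∏ k ∈ α.erase i, f c (x k) (x i)) •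
            (t o * mulH c x t (α.erase i) * a i)) * (wprod 1 a (U \ α) * N β)) := by
      intro i hi
      have hiU : i ∉ U \ α := fun e => (mem_sdiff.mp e).2 hi
      have e2 : U \ α.erase i = insert i (U \ α) := sdiff_erase (hα hi)
      rw [insert_erase hi, hW]
      simp only [e2, wprod_one_insert_left hE.aa hiU, smul_mul_assoc, smul_smul, mul_assoc]
      congr 1
      ring
    rw [sum_congr rfl e1, ← smul_sum, ← sum_mul]
    change _ = _ + _ • ((∑ i ∈ α, _ • (t o * wprod _ t (α.erase i) * a i)) * _)
    -- The sum of exchange terms is replaced by its value, the difference of the two orderings of `a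
    -- o` and the t's.
    have hm' := eq_sub_iff_add_eq'.mp hm
    rw [← eq_sub_iff_add_eq] at hm'
    rw [hm']
    simp only [hN, sub_mul, smul_sub, mul_smul_comm, smul_mul_assoc, smul_smul, mul_assoc]
    rw [add_sub_cancel]
    congr 1
    ring
  have h2 : ∀ α ∈ U.powerset, ∀ β ∈ V.powerset,
      (gOn c x x β (insert o α) * prod₂ (f c) x (insert o α) x (insert o U \ insert o α) *
          prod₂ (g c) x (V \ β) x β) •
        (mulH c x t (insert o α) * wprod 1 a (insert o U \ insert o α) *
          divH c x s (V \ β) * wprod 1 d β)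
      = (gOn c x x β (insert o α) * prod₂ (f c) x (insert o α) x (U \ α) *
          (∏ k ∈ α, h c (x o) (x k)) * prod₂ (g c) x (V \ β) x β) • W α β := by
    intro α hα β hβ
    rw [mem_powerset] at hα
    have hoα : o ∉ α := fun e => hoU (hα e)
    rw [insert_sdiff_insert, sdiff_insert_of_notMem hoU, mulH_insert hE.tt hoα, hW]
    simp only [hN, smul_mul_assoc, smul_smul, mul_assoc]
    congr 1
    ring
  have h3 : ∑ j ∈ V, recCoeff c x o U V j • (t o * sumX c x a d s t U (V.erase j) * d j)
      = ∑ α ∈ U.powerset, ∑ β ∈ V.powerset, ∑ j ∈ β, (g c (x j) (x o) *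
          (∏ k ∈ U, f c (x j) (x k)) * (∏ k ∈ β.erase j, g c (x k) (x j)) *
          (gOn c x x (β.erase j) α * prod₂ (f c) x α x (U \ α)) * prod₂ (g c) x (V \ β) x β) •
          W α β := by
    simp only [sumX, mul_sum, sum_mul, smul_sum]
    rw [sum_comm]
    refine sum_congr rfl fun α _ => ?_
    rw [sum_sum_powerset_erase V fun β j => recCoeff c x o U V j • (t o *
      ((gOn c x x β α * prod₂ (f c) x α x (U \ α) * prod₂ (g c) x (V.erase j \ β) x β) •
      (mulH c x t α * wprod 1 a (U \ α) * divH c x s (V.erase j \ β) * wprod 1 d β)) * d j)]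
    refine sum_congr rfl fun β hβ => sum_congr rfl fun j hj => ?_
    rw [mem_powerset] at hβ
    have q := prod₂_sdiff_erase (x := x) (g c) hβ hj
    have e := erase_sdiff_erase_of_mem V hj
    have e2 : wprod 1 d β = wprod 1 d (β.erase j) * d j := by
      rw [← wprod_one_insert_right hE.dd (notMem_erase j β), insert_erase hj]
    rw [e] at q ⊢
    rw [hW]
    simp only [hN, e2, mul_smul_comm, smul_mul_assoc, smul_smul, mul_assoc, recCoeff]
    congr 1
    linear_combination (g c (x j) (x o) * (∏ k ∈ U, f c (x j) (x k)) * gOn c x x (β.erase j) α *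
      prod₂ (f c) x α x (U \ α)) * q
  rw [h3, sumX, sum_powerset_insert hoU,
    sum_congr rfl fun α hα => sum_congr rfl fun β hβ => h1 α hα β hβ,
    sum_congr rfl fun α hα => sum_congr rfl fun β hβ => h2 α hα β hβ]
  simp only [sum_add_distrib]
  rw [add_assoc, sumX]
  congr 1
  · simp only [mul_sum]
  rw [sum_comm, sum_congr rfl fun β _ => sum_powerset_sum_erase U fun α i =>
    (gOn c x x β (insert i α) * prod₂ (f c) x (insert i α) x (U \ insert i α) *
            (g c (x i) (x o) * (∏ k ∈ α, h c (x i) (x k)) *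
              ∏ k ∈ α, f c (x k) (x i)) * prod₂ (g c) x (V \ β) x β) • W α β, sum_comm,
    ← sum_add_distrib]
  refine sum_congr rfl fun α hα => ?_
  rw [← sum_add_distrib]
  refine sum_congr rfl fun β hβ => ?_
  rw [mem_powerset] at hα hβ
  have H := gOn_recursion hc hx hoU (fun e => hoV (hβ e)) (hUV.mono_right hβ) hα
  rw [← sum_smul, ← sum_smul, ← add_smul, ← sum_mul, ← sum_mul, ← H]
  congr 1
  ring

/-- As for X, but `a o` is carried to the right end through the d's, so the exchange terms end in `d
o`; the coefficients are compared by `dwpfOn_recursion`. -/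
theorem sumY_insert (hE : IsExchangeFamily c x a d s t) (hc : c ≠ 0) (hx : Function.Injective x)
    {U V : Finset ι} {o : ι} (hoU : o ∉ U) (hoV : o ∉ V) (hUV : Disjoint U V)
    (hVV : ∀ j ∈ V, ∀ k ∈ V, h c (x j) (x k) ≠ 0)
    (hVU : ∀ j ∈ V, ∀ k ∈ insert o U, h c (x j) (x k) ≠ 0) :
    sumY c x a d s t (insert o U) V = sumY c x a d s t U V * a o
      + ∑ j ∈ V, recCoeff c x o U V j • (t j * sumY c x a d s t U (V.erase j) * d o) := by
  set N : Finset ι → A := fun β => divH c x t β * divH c x s (V \ β) with hN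
  set W : Finset ι → Finset ι → A :=
    fun α β => N β * wprod 1 a (U \ α) * wprod 1 d α * d o with hW
  have h1 : ∀ α ∈ U.powerset, ∀ β ∈ V.powerset,
      (dwpfOn c x x β α * prod₂ (f c) x α x (insert o U \ α) * prod₂ (g c) x (V \ β) x β) •
        (divH c x t β * divH c x s (V \ β) * wprod 1 a (insert o U \ α) * wprod 1 d α)
      = ((dwpfOn c x x β α * prod₂ (f c) x α x (U \ α) * prod₂ (g c) x (V \ β) x β) •
          (divH c x t β * divH c x s (V \ β) * wprod 1 a (U \ α) * wprod 1 d α)) * a o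
        + ∑ i ∈ α, (dwpfOn c x x β (insert i (α.erase i)) *
            prod₂ (f c) x (insert i (α.erase i)) x (U \ insert i (α.erase i)) *
            (g c (x i) (x o) * ∏ k ∈ α.erase i, f c (x k) (x i)) * prod₂ (g c) x (V \ β) x β) •
            W (α.erase i) β := by
    intro α hα β hβ
    rw [mem_powerset] at hα
    have hoα : o ∉ α := fun e => hoU (hα e)
    have ho' : o ∉ U \ α := fun e => hoU (mem_sdiff.mp e).1
    rw [insert_sdiff_of_notMem _ hoα, prod₂_insert_right _ _ _ _ ho',
      wprod_one_insert_right hE.aa ho']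
    have hm := wprod_one_mul hx hE.da hE.dd hoα
    have e1 : ∀ i ∈ α, (dwpfOn c x x β (insert i (α.erase i)) *
            prod₂ (f c) x (insert i (α.erase i)) x (U \ insert i (α.erase i)) *
            (g c (x i) (x o) * ∏ k ∈ α.erase i, f c (x k) (x i)) * prod₂ (g c) x (V \ β) x β) •
            W (α.erase i) β
        = (dwpfOn c x x β α * prod₂ (f c) x α x (U \ α) * prod₂ (g c) x (V \ β) x β) •
          ((N β * wprod 1 a (U \ α)) * ((g c (x i) (x o) * ∏ k ∈ α.erase i, f c (x k) (x i)) •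
            (a i * wprod 1 d (α.erase i) * d o))) := by
      intro i hi
      have hiU : i ∉ U \ α := fun e => (mem_sdiff.mp e).2 hi
      have e2 : U \ α.erase i = insert i (U \ α) := sdiff_erase (hα hi)
      rw [insert_erase hi, hW]
      simp only [e2, wprod_one_insert_right hE.aa hiU, mul_smul_comm, smul_smul, mul_assoc]
      congr 1
      ring
    rw [sum_congr rfl e1, ← smul_sum, ← mul_sum]
    have hm' := eq_sub_iff_add_eq'.mp hm
    rw [← eq_sub_iff_add_eq] at hm'
    rw [hm']
    simp only [hN, mul_sub, smul_sub, mul_smul_comm, smul_mul_assoc, smul_smul, mul_assoc]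
    rw [add_sub_cancel]
    congr 1
    ring
  have h2 : ∀ α ∈ U.powerset, ∀ β ∈ V.powerset,
      (dwpfOn c x x β (insert o α) * prod₂ (f c) x (insert o α) x (insert o U \ insert o α) *
          prod₂ (g c) x (V \ β) x β) •
        (divH c x t β * divH c x s (V \ β) * wprod 1 a (insert o U \ insert o α) *
          wprod 1 d (insert o α))
      = (dwpfOn c x x β (insert o α) * prod₂ (f c) x (insert o α) x (U \ α) *
          prod₂ (g c) x (V \ β) x β) • W α β := by
    intro α hα β hβ
    rw [mem_powerset] at hα
    have hoα : o ∉ α := fun e => hoU (hα e)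
    rw [insert_sdiff_insert, sdiff_insert_of_notMem hoU, wprod_one_insert_right hE.dd hoα, hW]
    simp only [hN, mul_assoc]
  have h3 : ∑ j ∈ V, recCoeff c x o U V j • (t j * sumY c x a d s t U (V.erase j) * d o)
      = ∑ α ∈ U.powerset, ∑ β ∈ V.powerset, ∑ j ∈ β, (g c (x j) (x o) *
          (∏ k ∈ U, f c (x j) (x k)) * (∏ k ∈ β.erase j, f c (x k) (x j)) *
          (dwpfOn c x x (β.erase j) α * prod₂ (f c) x α x (U \ α)) * prod₂ (g c) x (V \ β) x β) •
          W α β := by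
    simp only [sumY, mul_sum, sum_mul, smul_sum]
    rw [sum_comm]
    refine sum_congr rfl fun α _ => ?_
    rw [sum_sum_powerset_erase V fun β j => recCoeff c x o U V j • (t j *
      ((dwpfOn c x x β α * prod₂ (f c) x α x (U \ α) * prod₂ (g c) x (V.erase j \ β) x β) •
      (divH c x t β * divH c x s (V.erase j \ β) * wprod 1 a (U \ α) * wprod 1 d α)) * d o)]
    refine sum_congr rfl fun β hβ => sum_congr rfl fun j hj => ?_
    rw [mem_powerset] at hβ
    have q := prod₂_sdiff_erase (x := x) (g c) hβ hj
    have e := erase_sdiff_erase_of_mem V hj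
    -- Absorbing `t j` into the normalised product over β∖j costs ∏ h(x_k, x_j), which turns the g's
    -- of `recCoeff` over β∖j into the f's of `dwpfOn_recursion`.
    have e2 := mul_divH (c := c) (x := x) (t := t) hE.tt (notMem_erase j β)
      (by rw [insert_erase hj]; exact fun k hk l hl => hVV k (hβ hk) l (hβ hl))
    rw [insert_erase hj] at e2
    have q1 : ∏ k ∈ β.erase j, f c (x k) (x j)
        = (∏ k ∈ β.erase j, g c (x k) (x j)) * ∏ k ∈ β.erase j, h c (x k) (x j) := by
      rw [← prod_mul_distrib]
      exact prod_congr rfl fun k _ => f_eq_g_mul_h hc _ _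
    rw [e] at q ⊢
    rw [hW]
    simp only [mul_smul_comm, ← mul_assoc, e2]
    simp only [hN, q1, smul_mul_assoc, smul_smul, mul_assoc, recCoeff]
    congr 1
    linear_combination (g c (x j) (x o) * (∏ k ∈ U, f c (x j) (x k)) *
      dwpfOn c x x (β.erase j) α * prod₂ (f c) x α x (U \ α) *
      ∏ k ∈ β.erase j, h c (x k) (x j)) * q
  rw [h3, sumY, sum_powerset_insert hoU,
    sum_congr rfl fun α hα => sum_congr rfl fun β hβ => h1 α hα β hβ,
    sum_congr rfl fun α hα => sum_congr rfl fun β hβ => h2 α hα β hβ]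
  simp only [sum_add_distrib]
  rw [add_assoc, sumY]
  congr 1
  · simp only [sum_mul]
  rw [sum_comm, sum_congr rfl fun β _ => sum_powerset_sum_erase U fun α i =>
    (dwpfOn c x x β (insert i α) * prod₂ (f c) x (insert i α) x (U \ insert i α) *
            (g c (x i) (x o) * ∏ k ∈ α, f c (x k) (x i)) * prod₂ (g c) x (V \ β) x β) • W α β,
    sum_comm, ← sum_add_distrib]
  refine sum_congr rfl fun α hα => ?_
  rw [← sum_add_distrib]
  refine sum_congr rfl fun β hβ => ?_
  rw [mem_powerset] at hα hβ
  have H := dwpfOn_recursion hc hx hoU (fun e => hoV (hβ e)) (hUV.mono_right hβ) hα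
    fun j hj => hVU j (hβ hj)
  rw [← sum_smul, ← sum_smul, ← add_smul, ← sum_mul, ← sum_mul, ← H]
  congr 1
  ring

end Recursions

/-! ### Equality of X and Y -/

section Equality

variable {ι A : Type*} [LinearOrder ι] [Ring A] [Algebra ℂ A]
variable {c : ℂ} {x : ι → ℂ} {a d s t : ι → A}

/-- `mul_wprod` for the weights 1 / h, which reduce the factors f of the exchange terms to g. -/
theorem d_mul_divH (hE : IsExchangeFamily c x a d s t) (hc : c ≠ 0) (hx : Function.Injective x)
    {W : Finset ι} {o : ι} (ho : o ∉ W) (hWW : ∀ j ∈ W, ∀ k ∈ W, h c (x j) (x k) ≠ 0) :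
    d o * divH c x s W = (∏ i ∈ W, f c (x i) (x o)) • (divH c x s W * d o)
      - ∑ i ∈ W, (g c (x i) (x o) * ∏ j ∈ W.erase i, g c (x j) (x i)) •
          (s o * divH c x s (W.erase i) * d i) := by
  have := mul_wprod hc hx (w := fun i j => (h c (x j) (x i))⁻¹) hE.ds hE.ss (α := W)
    (fun i hi j hj hij => inv_h_smul_mul (hE.ss i j hij) (hWW i hi j hj) (hWW j hj i hi))
    (fun i hi j hj _ => by
      rw [mul_inv_cancel₀ (hWW j hj i hi), mul_inv_cancel₀ (hWW i hi j hj)]) ho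
  rw [divH, this]
  congr 1
  refine sum_congr rfl fun i hi => ?_
  congr 1
  rw [mul_assoc, ← prod_mul_distrib]
  congr 1
  refine prod_congr rfl fun j hj => ?_
  have := hWW j (mem_of_mem_erase hj) i hi
  rw [f_eq_g_mul_h hc]
  field_simp

/-- The case #U = 1 of X = Y. Peeling `s p` off the product, the commutator is s_p times the smaller
commutator plus g(x_p, x_o) (t_p d_o − t_o d_p) times the smaller product. Then s_p is carried
through the t's and the d's through the s's. -/
theorem a_mul_divH_sub (hE : IsExchangeFamily c x a d s t) (hc : c ≠ 0)
    (hx : Function.Injective x) {V : Finset ι} {o : ι} (ho : o ∉ V)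
    (hVV : ∀ j ∈ V, ∀ k ∈ V, h c (x j) (x k) ≠ 0) :
    a o * divH c x s V - divH c x s V * a o
      = ∑ j ∈ V, (g c (x j) (x o) * ∏ k ∈ V.erase j, g c (x k) (x j)) •
          (t j * divH c x s (V.erase j) * d o - t o * divH c x s (V.erase j) * d j) := by
  induction V using Finset.induction_on with
  | empty => simp [divH]
  | insert p W hp ih =>
    have hop : o ≠ p := fun e => ho (e ▸ mem_insert_self _ _)
    have hoW : o ∉ W := fun e => ho (mem_insert_of_mem e)
    have hWW : ∀ j ∈ W, ∀ k ∈ W, h c (x j) (x k) ≠ 0 := fun j hj k hk =>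
      hVV j (mem_insert_of_mem hj) k (mem_insert_of_mem hk)
    have hH : ∏ k ∈ W, h c (x k) (x p) ≠ 0 := prod_ne_zero_iff.mpr fun k hk =>
      hVV k (mem_insert_of_mem hk) p (mem_insert_self _ _)
    have hS := mul_divH (c := c) (x := x) (t := s) hE.ss hp hVV
    -- Clears the factors 1 / h between p and W, so that `s p` splits off without denominators.
    refine smul_right_injective A hH ?_
    simp only
    have hL : (∏ k ∈ W, h c (x k) (x p)) •
          (a o * divH c x s (insert p W) - divH c x s (insert p W) * a o)
        = s p * (a o * divH c x s W - divH c x s W * a o)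
          + g c (x p) (x o) • (t p * (d o * divH c x s W))
          - g c (x p) (x o) • (t o * (d p * divH c x s W)) := by
      rw [smul_sub, ← mul_smul_comm, ← smul_mul_assoc, ← hS, ← mul_assoc,
        ← sub_add_cancel (a o * s p) (s p * a o), hE.as o p hop]
      simp only [add_mul, sub_mul, mul_sub, smul_mul_assoc, mul_assoc, smul_sub]
      abel
    rw [hL, ih hoW hWW, d_mul_divH hE hc hx hoW hWW, d_mul_divH hE hc hx hp hWW, sum_insert hp,
      erase_insert hp, smul_add, mul_sum]
    have eR : ∀ j ∈ W, (∏ k ∈ W, h c (x k) (x p)) • ((g c (x j) (x o) *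
          ∏ k ∈ (insert p W).erase j, g c (x k) (x j)) •
          (t j * divH c x s ((insert p W).erase j) * d o
            - t o * divH c x s ((insert p W).erase j) * d j))
        = (h c (x j) (x p) * g c (x p) (x j) * (g c (x j) (x o) *
            ∏ k ∈ W.erase j, g c (x k) (x j))) •
          (t j * (s p * divH c x s (W.erase j)) * d o
            - t o * (s p * divH c x s (W.erase j)) * d j) := by
      intro j hj
      have hjp : j ≠ p := fun e => hp (e ▸ hj)
      have hpj : p ∉ W.erase j := fun e => hp (mem_of_mem_erase e)
      rw [erase_insert_of_ne hjp.symm, prod_insert hpj, mul_divH (c := c) (x := x) hE.ss hpj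
        (fun k hk l hl => hVV k (insert_subset_insert _ (erase_subset _ _) hk) l
          (insert_subset_insert _ (erase_subset _ _) hl)), ← mul_prod_erase W _ hj]
      simp only [mul_smul_comm, smul_mul_assoc, ← smul_sub, smul_smul]
      congr 1
      ring
    -- Four groups arise: the wanted terms; multiples of `t p * divH c x s W * d o`, summed later by
    -- `sum_residues_right`; and two groups that cancel the exchange terms of `d o` and `d p`
    -- passing the s's.
    have eL : ∀ j ∈ W, s p * ((g c (x j) (x o) * ∏ k ∈ W.erase j, g c (x k) (x j)) •
          (t j * divH c x s (W.erase j) * d o - t o * divH c x s (W.erase j) * d j))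
        = (h c (x j) (x p) * g c (x p) (x j) * (g c (x j) (x o) *
            ∏ k ∈ W.erase j, g c (x k) (x j))) •
          (t j * (s p * divH c x s (W.erase j)) * d o
            - t o * (s p * divH c x s (W.erase j)) * d j)
          - (g c (x j) (x o) * g c (x p) (x j) * ∏ k ∈ W.erase j, f c (x k) (x j)) •
            (t p * divH c x s W * d o)
          + g c (x p) (x o) • (t p * ((g c (x j) (x o) * ∏ k ∈ W.erase j, g c (x k) (x j)) •
            (s o * divH c x s (W.erase j) * d j)))
          - g c (x p) (x o) • (t o * ((g c (x j) (x p) * ∏ k ∈ W.erase j, g c (x k) (x j)) •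
            (s p * divH c x s (W.erase j) * d j))) := by
      intro j hj
      have hjp : j ≠ p := fun e => hp (e ▸ hj)
      have hoj : o ≠ j := fun e => hoW (e ▸ hj)
      have q := mul_divH (c := c) (x := x) (t := s) hE.ss (notMem_erase j W)
        (by rw [insert_erase hj]; exact hWW)
      rw [insert_erase hj] at q
      have q1 : ∏ k ∈ W.erase j, f c (x k) (x j)
          = (∏ k ∈ W.erase j, g c (x k) (x j)) * ∏ k ∈ W.erase j, h c (x k) (x j) := by
        rw [← prod_mul_distrib]
        exact prod_congr rfl fun k _ => f_eq_g_mul_h hc _ _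
      have e1 : s p * (t j * divH c x s (W.erase j) * d o)
          = -(f c (x j) (x p) • (t j * (s p * divH c x s (W.erase j)) * d o))
            - (g c (x p) (x j) * ∏ k ∈ W.erase j, h c (x k) (x j)) •
              (t p * divH c x s W * d o) := by
        rw [mul_smul, ← smul_mul_assoc (∏ k ∈ W.erase j, h c (x k) (x j)),
          ← mul_smul_comm (∏ k ∈ W.erase j, h c (x k) (x j)), ← q,
          ← mul_assoc, ← mul_assoc, hE.st p j hjp.symm]
        simp only [sub_mul, neg_mul, smul_mul_assoc, mul_assoc]
      have e2 : s p * (t o * divH c x s (W.erase j) * d j)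
          = -(f c (x o) (x p) • (t o * (s p * divH c x s (W.erase j)) * d j))
            - g c (x p) (x o) • (t p * (s o * divH c x s (W.erase j) * d j)) := by
        rw [← mul_assoc, ← mul_assoc, hE.st p o hop.symm]
        simp only [sub_mul, neg_mul, smul_mul_assoc, mul_assoc]
      rw [mul_smul_comm, mul_sub, e1, e2, q1]
      have s1 : h c (x j) (x p) * g c (x p) (x j) = -f c (x j) (x p) := by
        rw [f_eq_g_mul_h hc, g_swap]; ring
      have s2 : g c (x j) (x o) * f c (x o) (x p) + g c (x p) (x o) * g c (x j) (x p)
          = g c (x j) (x o) * f c (x j) (x p) := by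
        rw [f_eq_one_add_g (hx.ne hop), f_eq_one_add_g (hx.ne hjp), g_swap (x p) (x o)]
        linear_combination g_mul_g (c := c) (hx.ne hjp) (hx.ne hop.symm) (hx.ne hoj.symm)
      generalize ∏ k ∈ W.erase j, g c (x k) (x j) = r at *
      have s3 : (f c (x o) (x p) * g c (x j) (x o) * r + g c (x p) (x o) * (g c (x j) (x p) * r))
          = f c (x j) (x p) * (g c (x j) (x o) * r) := by linear_combination r * s2
      rw [s1]
      simp only [smul_sub, smul_neg, neg_mul, neg_smul, mul_smul_comm, smul_smul, ← mul_assoc]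
      rw [← mul_assoc, ← mul_assoc] at s3
      rw [← s3, add_smul]
      have r1 : g c (x j) (x o) * r * f c (x j) (x p) = f c (x j) (x p) * g c (x j) (x o) * r := by
        ring
      have r2 : g c (x j) (x o) * r * g c (x p) (x j) * ∏ k ∈ W.erase j, h c (x k) (x j)
          = g c (x j) (x o) * g c (x p) (x j) * r * ∏ k ∈ W.erase j, h c (x k) (x j) := by ring
      have r3 : g c (x j) (x o) * r * f c (x o) (x p) = f c (x o) (x p) * g c (x j) (x o) * r := by
        ring
      have r4 : g c (x j) (x o) * r * g c (x p) (x o) = g c (x p) (x o) * g c (x j) (x o) * r := by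
        ring
      have r5 : f c (x j) (x p) * g c (x j) (x o) * r
          = f c (x o) (x p) * g c (x j) (x o) * r + g c (x p) (x o) * g c (x j) (x p) * r := s3.symm
      rw [r1, r2, r3, r4, r5]
      simp only [add_smul]
      abel
    rw [sum_congr rfl eL, smul_sum, sum_congr rfl eR]
    simp only [sum_sub_distrib, sum_add_distrib, mul_sub, smul_sub, mul_sum, smul_sum, ← sum_smul]
    have key := sum_residues_right (c := c) hc hx hop hoW hp
    have q2 : (∏ k ∈ W, h c (x k) (x p)) * (g c (x p) (x o) * ∏ k ∈ W, g c (x k) (x p))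
        = g c (x p) (x o) * ∏ k ∈ W, f c (x k) (x p) := by
      have : ∏ k ∈ W, f c (x k) (x p)
          = (∏ k ∈ W, g c (x k) (x p)) * ∏ k ∈ W, h c (x k) (x p) := by
        rw [← prod_mul_distrib]
        exact prod_congr rfl fun k _ => f_eq_g_mul_h hc _ _
      rw [this]; ring
    have q3 : (g c (x p) (x o) * ∏ i ∈ W, f c (x i) (x p)) • (t p * divH c x s W * d o)
        = (g c (x p) (x o) * ∏ i ∈ W, f c (x i) (x o)) • (t p * divH c x s W * d o)
          - (∑ i ∈ W, g c (x i) (x o) * g c (x p) (x i) * ∏ k ∈ W.erase i, f c (x k) (x i)) •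
            (t p * divH c x s W * d o) := by
      rw [← sub_smul, key]
    simp only [smul_smul, q2, mul_smul_comm]
    rw [q3]
    simp only [mul_assoc]
    abel

theorem sumX_empty_left (V : Finset ι) : sumX c x a d s t ∅ V = divH c x s V := by
  rw [sumX, powerset_empty, sum_singleton, sum_eq_single_of_mem ∅ (empty_mem_powerset V)]
  · simp [gOn, prod₂, mulH]
  · intro β _ hβ
    rw [gOn, if_neg (by simpa using hβ)]
    simp

theorem sumY_empty_left (V : Finset ι) : sumY c x a d s t ∅ V = divH c x s V := by
  rw [sumY, powerset_empty, sum_singleton, sum_eq_single_of_mem ∅ (empty_mem_powerset V)]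
  · rw [dwpfOn_eq c x x card_empty card_empty]
    simp [dwpf, prod₂, divH]
  · intro β _ hβ
    rw [dwpfOn_of_card_ne _ _ _ (by simpa using hβ)]
    simp

/-- The total coefficient of t_o t_k B(V∖{j,k}) d_j d_q in the comparison below. Up to common
factors it is a combination of the three-term identity at (x_k, x_j, x_q) and at (x_k, x_j, x_o). -/
theorem recCoeff_cancel (hx : Function.Injective x) {U V : Finset ι} {o q j k : ι}
    (hoV : o ∉ V) (hqV : q ∉ V) (hj : j ∈ V) (hk : k ∈ V)
    (hjk : j ≠ k) :
    recCoeff c x o U V j * f c (x j) (x q) * recCoeff c x q U (V.erase j) k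
      - recCoeff c x o U V j * g c (x j) (x q) * recCoeff c x j U (V.erase j) k
      + (recCoeff c x o U V k * g c (x k) (x q) * recCoeff c x k U (V.erase k) j
        - recCoeff c x q U V k * (g c (x k) (x o) - 1) * recCoeff c x o U (V.erase k) j) = 0 := by
  have hko : k ≠ o := fun e => hoV (e ▸ hk)
  have hjo : j ≠ o := fun e => hoV (e ▸ hj)
  have hkq : k ≠ q := fun e => hqV (e ▸ hk)
  have hjq : j ≠ q := fun e => hqV (e ▸ hj)
  simp only [recCoeff]
  rw [← mul_prod_erase (V.erase j) (fun l => g c (x l) (x j)) (mem_erase.mpr ⟨hjk.symm, hk⟩),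
    ← mul_prod_erase (V.erase k) (fun l => g c (x l) (x k)) (mem_erase.mpr ⟨hjk, hj⟩),
    erase_right_comm (a := k), f_eq_one_add_g (hx.ne hjq), g_swap (x k) (x j)]
  linear_combination (∏ l ∈ U, f c (x j) (x l)) * (∏ l ∈ U, f c (x k) (x l)) *
    (∏ l ∈ (V.erase j).erase k, g c (x l) (x j)) * (∏ l ∈ (V.erase j).erase k, g c (x l) (x k)) *
    g c (x k) (x j) * (g c (x j) (x o) * -g_mul_g (c := c) (hx.ne hjk.symm) (hx.ne hjq) (hx.ne hkq)
      + -g c (x k) (x q) * g_mul_g (c := c) (hx.ne hjk.symm) (hx.ne hjo) (hx.ne hko))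

/-- Left peeling of o and right peeling of q are done in both orders: X first, then Y for q∪U; or Y
first, then X for o∪U. The term a_o B a_q is common to both, and the terms linear in t differ by
commutators [a_j, B], which `ihV` evaluates. -/
theorem sumX_insert_insert_eq (hE : IsExchangeFamily c x a d s t) (hc : c ≠ 0)
    (hx : Function.Injective x) {U V : Finset ι} {o q : ι} (hoq : o ≠ q) (hoU : o ∉ U)
    (hqU : q ∉ U) (hoV : o ∉ V) (hqV : q ∉ V) (hUV : Disjoint U V)
    (hVV : ∀ j ∈ V, ∀ k ∈ V, h c (x j) (x k) ≠ 0)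
    (hVU : ∀ j ∈ V, ∀ k ∈ insert o (insert q U), h c (x j) (x k) ≠ 0)
    (ih0 : ∀ V' ⊆ V, sumX c x a d s t U V' = sumY c x a d s t U V')
    (iho : ∀ V' ⊆ V, sumX c x a d s t (insert o U) V' = sumY c x a d s t (insert o U) V')
    (ihq : ∀ V' ⊆ V, sumX c x a d s t (insert q U) V' = sumY c x a d s t (insert q U) V')
    (ihV : ∀ j ∈ V, sumX c x a d s t (insert j U) (V.erase j)
      = sumY c x a d s t (insert j U) (V.erase j)) :
    sumX c x a d s t (insert o (insert q U)) V = sumY c x a d s t (insert o (insert q U)) V := by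
  set B : Finset ι → A := sumX c x a d s t U with hB
  have hVU' : ∀ j ∈ V, ∀ k ∈ insert q U, h c (x j) (x k) ≠ 0 := fun j hj k hk =>
    hVU j hj k (mem_insert_of_mem hk)
  -- the recursions with one further element of `U`
  have hq : ∀ V' ⊆ V, sumX c x a d s t (insert q U) V' = B V' * a q
      + ∑ k ∈ V', recCoeff c x q U V' k • (t k * B (V'.erase k) * d q) := by
    intro V' hV'
    rw [ihq V' hV', sumY_insert hE hc hx hqU (fun e => hqV (hV' e)) (hUV.mono_right hV')
      (fun j hj k hk => hVV j (hV' hj) k (hV' hk)) fun j hj => hVU' j (hV' hj), ← ih0 V' hV']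
    congr 1
    exact sum_congr rfl fun k _ => by rw [← ih0 _ ((erase_subset _ _).trans hV')]
  have ho : ∀ V' ⊆ V, sumY c x a d s t (insert o U) V' = a o * B V'
      + ∑ k ∈ V', recCoeff c x o U V' k • (t o * B (V'.erase k) * d k) := by
    intro V' hV'
    rw [← iho V' hV', sumX_insert hE hc hx hoU (fun e => hoV (hV' e)) (hUV.mono_right hV')]
  -- The equality X = Y for j∪U and V∖j becomes a commutator formula once each side is replaced by
  -- its own recursion.
  have hj : ∀ j ∈ V, a j * B (V.erase j) - B (V.erase j) * a j
      = ∑ k ∈ V.erase j, recCoeff c x j U (V.erase j) k •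
        (t k * B ((V.erase j).erase k) * d j - t j * B ((V.erase j).erase k) * d k) := by
    intro j hj
    have hjU : j ∉ U := disjoint_right.mp hUV hj
    have hsub := erase_subset j V
    have e := ihV j hj
    rw [sumX_insert hE hc hx hjU (notMem_erase _ _) (hUV.mono_right hsub),
      sumY_insert hE hc hx hjU (notMem_erase _ _) (hUV.mono_right hsub)
        (fun k hk l hl => hVV k (hsub hk) l (hsub hl)), ← ih0 _ hsub] at e
    · simp only [smul_sub, sum_sub_distrib]
      have e' : ∑ k ∈ V.erase j, recCoeff c x j U (V.erase j) k •
            (t k * B ((V.erase j).erase k) * d j)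
          = ∑ k ∈ V.erase j, recCoeff c x j U (V.erase j) k •
            (t k * sumY c x a d s t U ((V.erase j).erase k) * d j) :=
        sum_congr rfl fun k _ => by rw [← ih0 _ ((erase_subset _ _).trans hsub)]
      rw [e', sub_eq_sub_iff_add_eq_add, add_comm _ (B (V.erase j) * a j), ← e]
    · intro k hk l hl
      rcases mem_insert.mp hl with rfl | hl
      · exact hVV k (hsub hk) _ hj
      · exact hVU' k (hsub hk) l (mem_insert_of_mem hl)
  set P : ι → ι → A := fun j k => t o * t k * B ((V.erase j).erase k) * d j * d q with hP
  have hX : sumX c x a d s t (insert o (insert q U)) V = a o * B V * a q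
      + ∑ j ∈ V, (recCoeff c x q U V j • (a o * t j * B (V.erase j) * d q)
          + (recCoeff c x o U V j * f c (x j) (x q)) • (t o * B (V.erase j) * a q * d j))
      + ∑ j ∈ V, ∑ k ∈ V.erase j, (recCoeff c x o U V j * f c (x j) (x q) *
          recCoeff c x q U (V.erase j) k) • P j k := by
    rw [sumX_insert hE hc hx (by simp [hoq, hoU]) hoV (disjoint_insert_left.mpr ⟨hqV, hUV⟩),
      hq V subset_rfl, mul_add, ← mul_assoc, add_assoc, add_assoc, mul_sum, ← sum_add_distrib,
      ← sum_add_distrib]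
    congr 1
    refine sum_congr rfl fun j hj => ?_
    rw [add_assoc]
    congr 1
    · simp only [mul_smul_comm, mul_assoc]
    · rw [hq _ (erase_subset _ _), mul_add, add_mul, smul_add, mul_sum, sum_mul, smul_sum]
      have e : recCoeff c x o (insert q U) V j = recCoeff c x o U V j * f c (x j) (x q) := by
        rw [recCoeff, recCoeff, prod_insert hqU]; ring
      rw [e]
      congr 1
      · simp only [mul_assoc]
      · refine sum_congr rfl fun k _ => ?_
        simp only [hP, mul_smul_comm, smul_mul_assoc, smul_smul, mul_assoc, hE.dd q j]
  have hY : sumY c x a d s t (insert o (insert q U)) V = a o * B V * a q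
      + ∑ j ∈ V, ((recCoeff c x q U V j * f c (x j) (x o)) • (t j * a o * B (V.erase j) * d q)
          + recCoeff c x o U V j • (t o * B (V.erase j) * d j * a q))
      + ∑ j ∈ V, ∑ k ∈ V.erase j, (recCoeff c x q U V j * (g c (x j) (x o) - 1) *
          recCoeff c x o U (V.erase j) k) • P k j := by
    have hVU'' : ∀ j ∈ V, ∀ k ∈ insert q (insert o U), h c (x j) (x k) ≠ 0 := by
      rwa [insert_comm]
    rw [insert_comm, sumY_insert hE hc hx (by simp [hoq.symm, hqU]) hqV
        (disjoint_insert_left.mpr ⟨hoV, hUV⟩) hVV hVU'',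
      ho V subset_rfl, add_mul, add_assoc, add_assoc, sum_mul, ← sum_add_distrib,
      ← sum_add_distrib]
    congr 1
    refine sum_congr rfl fun j hj => ?_
    rw [add_comm (_ • (t j * a o * _ * _)), add_assoc]
    congr 1
    · simp only [smul_mul_assoc]
    · rw [ho _ (erase_subset _ _), mul_add, add_mul, smul_add, mul_sum, sum_mul, smul_sum]
      have e : recCoeff c x q (insert o U) V j = recCoeff c x q U V j * f c (x j) (x o) := by
        rw [recCoeff, recCoeff, prod_insert hoU]; ring
      have hjo : j ≠ o := fun e => hoV (e ▸ hj)
      have e3 : f c (x j) (x o) • (t j * t o) = (g c (x j) (x o) - 1) • (t o * t j) := by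
        rw [f_eq_g_mul_h hc, mul_smul, hE.tt j o hjo, smul_smul, g_mul_h_swap hc (hx.ne hjo)]
      rw [e]
      congr 1
      · simp only [mul_assoc]
      · refine sum_congr rfl fun k _ => ?_
        have e4 := congrArg (fun z => (recCoeff c x q U V j * recCoeff c x o U (V.erase j) k) •
          (z * (B ((V.erase j).erase k) * (d k * d q)))) e3
        simp only [hP, smul_mul_assoc, smul_smul, mul_assoc, mul_smul_comm] at e4 ⊢
        rw [erase_right_comm (a := k), mul_comm (f c (x j) (x o)), e4]
        congr 1
        ring
  -- Carrying a_o past t_j and d_j past a_q gives two exchange terms. As r_j(q) g(x_j, x_o) = r_j(o)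
  -- g(x_j, x_q), they combine into t_o [a_j, B(V∖j)] d_q, to which `hj` applies.
  have hD : ∀ j ∈ V, (recCoeff c x q U V j • (a o * t j * B (V.erase j) * d q)
          + (recCoeff c x o U V j * f c (x j) (x q)) • (t o * B (V.erase j) * a q * d j))
        = ((recCoeff c x q U V j * f c (x j) (x o)) • (t j * a o * B (V.erase j) * d q)
          + recCoeff c x o U V j • (t o * B (V.erase j) * d j * a q))
          - ∑ k ∈ V.erase j, ((recCoeff c x o U V j * g c (x j) (x q) *
              recCoeff c x j U (V.erase j) k) • P j k
            - (recCoeff c x o U V j * g c (x j) (x q) *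
              recCoeff c x j U (V.erase j) k) • P k j) := by
    intro j hjV
    have hjo : o ≠ j := fun e => hoV (e ▸ hjV)
    have hjq : j ≠ q := fun e => hqV (e ▸ hjV)
    have e : recCoeff c x q U V j * g c (x j) (x o) = recCoeff c x o U V j * g c (x j) (x q) := by
      rw [recCoeff, recCoeff]; ring
    have e5 : ∑ k ∈ V.erase j, ((recCoeff c x o U V j * g c (x j) (x q) *
              recCoeff c x j U (V.erase j) k) • P j k
            - (recCoeff c x o U V j * g c (x j) (x q) *
              recCoeff c x j U (V.erase j) k) • P k j)
        = (recCoeff c x o U V j * g c (x j) (x q)) •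
          (t o * (a j * B (V.erase j) - B (V.erase j) * a j) * d q) := by
      rw [hj j hjV, mul_sum, sum_mul, smul_sum]
      refine sum_congr rfl fun k _ => ?_
      simp only [hP, mul_smul_comm, smul_mul_assoc, smul_smul, mul_sub, sub_mul, smul_sub,
        mul_assoc, erase_right_comm (a := k) (b := j)]
    have e6 : t o * B (V.erase j) * d j * a q = f c (x j) (x q) • (t o * B (V.erase j) * a q * d j)
        - g c (x j) (x q) • (t o * B (V.erase j) * a j * d q) := by
      rw [mul_assoc _ (d j), hE.da j q hjq]
      simp only [mul_sub, mul_smul_comm, mul_assoc]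
    rw [e5, hE.at_ o j hjo, e6]
    simp only [mul_sub, sub_mul, smul_sub, smul_mul_assoc, smul_smul, e, mul_assoc]
    abel
  have hswap : ∀ F : ι → ι → A, ∑ j ∈ V, ∑ k ∈ V.erase j, F j k
      = ∑ j ∈ V, ∑ k ∈ V.erase j, F k j := fun F =>
    sum_comm' fun j k => by simp only [mem_erase]; tauto
  rw [hX, hY, sum_congr rfl hD, sum_sub_distrib, add_assoc, add_assoc]
  congr 1
  rw [sub_add_eq_add_sub, sub_eq_iff_eq_add, add_assoc]
  congr 1
  simp only [sum_sub_distrib]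
  rw [hswap fun j k => (recCoeff c x o U V j * g c (x j) (x q) *
      recCoeff c x j U (V.erase j) k) • P k j,
    hswap fun j k => (recCoeff c x q U V j * (g c (x j) (x o) - 1) *
      recCoeff c x o U (V.erase j) k) • P k j, ← sub_eq_zero]
  simp only [← sum_sub_distrib, ← sum_add_distrib]
  refine sum_eq_zero fun j hjV => sum_eq_zero fun k hk => ?_
  rw [← sub_smul, ← add_smul, ← sub_smul]
  have := recCoeff_cancel (c := c) (U := U) hx hoV hqV hjV (mem_of_mem_erase hk)
    (ne_of_mem_erase hk).symm
  refine (congrArg (· • P j k) (?_ : _ = (0 : ℂ))).trans (zero_smul ℂ _)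
  linear_combination this

/-- Strong induction on #U for all U and V at once, since the step needs smaller V and also sets U
containing elements of V. One-element sets are treated apart because the step removes two elements.
-/
theorem sumX_eq_sumY (hE : IsExchangeFamily c x a d s t) (hc : c ≠ 0) (hx : Function.Injective x)
    {U V : Finset ι} (hUV : Disjoint U V) (hVV : ∀ j ∈ V, ∀ k ∈ V, h c (x j) (x k) ≠ 0)
    (hVU : ∀ j ∈ V, ∀ k ∈ U, h c (x j) (x k) ≠ 0) :
    sumX c x a d s t U V = sumY c x a d s t U V := by
  induction hn : #U using Nat.strong_induction_on generalizing U V with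
  | _ n ih =>
    rcases U.eq_empty_or_nonempty with rfl | ⟨o, hoU⟩
    · rw [sumX_empty_left, sumY_empty_left]
    obtain ⟨U, hoU', rfl⟩ : ∃ U', o ∉ U' ∧ insert o U' = U :=
      ⟨U.erase o, notMem_erase _ _, insert_erase hoU⟩
    obtain ⟨hoV, hUV'⟩ := disjoint_insert_left.mp hUV
    rcases U.eq_empty_or_nonempty with rfl | ⟨q, hqU⟩
    · rw [sumX_insert hE hc hx hoU' hoV hUV', sumY_insert hE hc hx hoU' hoV hUV' hVV hVU]
      simp only [sumX_empty_left, sumY_empty_left]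
      have := a_mul_divH_sub hE hc hx hoV hVV
      rw [sub_eq_iff_eq_add] at this
      rw [this]
      simp only [recCoeff, smul_sub, sum_sub_distrib, prod_empty, mul_one]
      abel
    obtain ⟨U, hqU', rfl⟩ : ∃ U', q ∉ U' ∧ insert q U' = U :=
      ⟨U.erase q, notMem_erase _ _, insert_erase hqU⟩
    obtain ⟨hqV, hUV''⟩ := disjoint_insert_left.mp hUV'
    have hoq : o ≠ q := fun e => hoU' (e ▸ mem_insert_self _ _)
    have hoU'' : o ∉ U := fun e => hoU' (mem_insert_of_mem e)
    rw [card_insert_of_notMem hoU', card_insert_of_notMem hqU'] at hn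
    refine sumX_insert_insert_eq hE hc hx hoq hoU'' hqU' hoV hqV hUV'' hVV hVU ?_ ?_ ?_ ?_
    · intro V' hV'
      exact ih _ (by omega) (hUV''.mono_right hV') (fun j hj k hk => hVV j (hV' hj) k (hV' hk))
        (fun j hj k hk => hVU j (hV' hj) k (by simp [hk])) rfl
    · intro V' hV'
      refine ih (#U + 1) (by omega) (disjoint_insert_left.mpr
        ⟨fun e => hoV (hV' e), hUV''.mono_right hV'⟩)
        (fun j hj k hk => hVV j (hV' hj) k (hV' hk))
        (fun j hj k hk => hVU j (hV' hj) k ?_) (card_insert_of_notMem hoU'')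
      simp only [mem_insert] at hk ⊢; tauto
    · intro V' hV'
      exact ih (#U + 1) (by omega) (hUV'.mono_right hV')
        (fun j hj k hk => hVV j (hV' hj) k (hV' hk))
        (fun j hj k hk => hVU j (hV' hj) k (mem_insert_of_mem hk)) (card_insert_of_notMem hqU')
    · intro j hj
      have hsub := erase_subset j V
      refine ih (#U + 1) (by omega) (disjoint_insert_left.mpr
        ⟨notMem_erase _ _, hUV''.mono_right hsub⟩)
        (fun j hj k hk => hVV j (hsub hj) k (hsub hk)) (fun k hk l hl => ?_)
        (card_insert_of_notMem (disjoint_right.mp hUV'' hj))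
      rcases mem_insert.mp hl with rfl | hl
      · exact hVV k (hsub hk) _ hj
      · exact hVU k (hsub hk) l (by simp [hl])

end Equality

/-! ### Exchange relations from the monodromy relations -/

section Relations

variable {A : Type*} [Ring A] [Algebra ℂ A] {c : ℂ} {D : Set ℂ} {T : Fin 3 → Fin 3 → ℂ → A}

/-- The relation and its copy with u and v interchanged say that the commutator is both −g and g
times itself. Adding them avoids division by 1 + g, which may vanish. -/
theorem IsMonodromy.commute_even (hT : IsMonodromy c D T) {i j : Fin 3}
    (hi : par i = 0) (hj : par j = 0) {u v : ℂ} (hu : u ∈ D) (hv : v ∈ D) :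
    T i j u * T i j v = T i j v * T i j u := by
  rcases eq_or_ne u v with rfl | huv
  · rfl
  have h1 := hT i j i j u hu v hv huv
  have h2 := hT i j i j v hv u hu huv.symm
  simp only [hi, hj, add_zero, mul_zero, pow_zero, one_smul, one_mul, g_swap u v,
    neg_smul] at h1 h2
  have h3 : T i j u * T i j v - T i j v * T i j u
      = -(g c u v • (T i j u * T i j v - T i j v * T i j u)) := by
    rw [← smul_neg, neg_sub]; exact h1
  have h4 : T i j u * T i j v - T i j v * T i j u
      = g c u v • (T i j u * T i j v - T i j v * T i j u) :=
    neg_injective (by rw [neg_sub]; exact h2)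
  have h5 : (2 : ℂ) • (T i j u * T i j v - T i j v * T i j u) = 0 := by
    rw [two_smul]
    exact add_eq_zero_iff_eq_neg.mpr (h3.trans (congrArg Neg.neg h4.symm))
  exact sub_eq_zero.mp ((smul_eq_zero.mp h5).resolve_left two_ne_zero)

/-- The relation divided by g(u, v), since h(u, v) = 1 / g(u, v) + 1. -/
theorem IsMonodromy.column_symm (hT : IsMonodromy c D T) (hc : c ≠ 0) {i : Fin 3}
    (hi : par i = 0) {u v : ℂ} (hu : u ∈ D) (hv : v ∈ D) (huv : u ≠ v) :
    h c u v • (T i 2 u * T i 2 v) = h c v u • (T i 2 v * T i 2 u) := by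
  have h1 := hT i 2 i 2 u hu v hv huv
  simp [hi, show par 2 = 1 from rfl] at h1
  have h2 : u - v ≠ 0 := sub_ne_zero.mpr huv
  have e : ((u - v) / c) * g c u v = 1 := by rw [g]; field_simp
  have h3 := congrArg (((u - v) / c) • ·) h1
  simp only [smul_smul, e, one_smul, smul_add] at h3
  have e1 : h c u v = (u - v) / c + 1 := by rw [h]; field_simp
  have e2 : h c v u = -((u - v) / c) + 1 := by rw [h]; field_simp; ring
  rw [e1, e2, add_smul, add_smul, one_smul, one_smul, neg_smul]
  rw [← sub_eq_zero] at h3 ⊢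
  rw [← h3]
  abel

theorem IsMonodromy.row_symm (hT : IsMonodromy c D T) (hc : c ≠ 0) {i : Fin 3}
    (hi : par i = 0) {u v : ℂ} (hu : u ∈ D) (hv : v ∈ D) (huv : u ≠ v) :
    h c v u • (T 2 i u * T 2 i v) = h c u v • (T 2 i v * T 2 i u) := by
  have h1 := hT 2 i 2 i u hu v hv huv
  simp [hi, show par 2 = 1 from rfl] at h1
  have h2 : u - v ≠ 0 := sub_ne_zero.mpr huv
  have e : ((u - v) / c) * g c u v = 1 := by rw [g]; field_simp
  have h3 := congrArg (((u - v) / c) • ·) h1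
  simp only [smul_neg, smul_smul, e, one_smul, smul_add] at h3
  have e1 : h c u v = (u - v) / c + 1 := by rw [h]; field_simp
  have e2 : h c v u = -((u - v) / c) + 1 := by rw [h]; field_simp; ring
  rw [e1, e2, add_smul, add_smul, one_smul, one_smul, neg_smul]
  rw [← sub_eq_zero] at h3 ⊢
  rw [← neg_eq_zero, ← h3]
  abel

theorem IsMonodromy.isExchangeFamily (hT : IsMonodromy c D T) (hc : c ≠ 0) {ι : Type*} {x : ι → ℂ}
    (hx : Function.Injective x) (hxD : ∀ i, x i ∈ D) :
    IsExchangeFamily c x (T 0 1 ∘ x) (T 1 1 ∘ x) (T 1 2 ∘ x) (T 0 2 ∘ x) where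
  aa i j := hT.commute_even rfl rfl (hxD i) (hxD j)
  dd i j := hT.commute_even rfl rfl (hxD i) (hxD j)
  ss i j hij := hT.column_symm hc rfl (hxD i) (hxD j) (hx.ne hij)
  tt i j hij := hT.column_symm hc rfl (hxD i) (hxD j) (hx.ne hij)
  at_ i j hij := by
    have h1 := hT 0 2 0 1 _ (hxD j) _ (hxD i) (hx.ne hij.symm)
    simp [par] at h1
    rw [f_eq_one_add_g (hx.ne hij.symm)]
    simp only [Function.comp_apply, add_smul, one_smul]
    rw [smul_sub, ← sub_eq_zero] at h1
    rw [← sub_eq_zero, ← neg_eq_zero, ← h1]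
    abel
  da i j hij := by
    have h1 := hT 1 1 0 1 _ (hxD i) _ (hxD j) (hx.ne hij)
    simp [par] at h1
    rw [f_eq_one_add_g (hx.ne hij)]
    simp only [Function.comp_apply, add_smul, one_smul]
    rw [smul_sub, ← sub_eq_zero] at h1
    rw [← sub_eq_zero, ← h1]
    abel
  ds i j hij := by
    have h1 := hT 1 2 1 1 _ (hxD j) _ (hxD i) (hx.ne hij.symm)
    simp [par] at h1
    rw [f_eq_one_add_g (hx.ne hij.symm)]
    simp only [Function.comp_apply, add_smul, one_smul]
    rw [smul_sub, ← sub_eq_zero] at h1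
    rw [← sub_eq_zero, ← neg_eq_zero, ← h1]
    abel
  as i j hij := by
    have h1 := hT 1 2 0 1 _ (hxD j) _ (hxD i) (hx.ne hij.symm)
    simp [par] at h1
    simp only [Function.comp_apply]
    rw [← neg_sub, h1, ← smul_neg, neg_sub]
  st i j hij := by
    have h1 := hT 1 2 0 2 _ (hxD i) _ (hxD j) (hx.ne hij)
    simp [par] at h1
    rw [f_eq_one_add_g (hx.ne hij.symm), g_swap (x i) (x j)]
    simp only [Function.comp_apply, add_smul, one_smul, neg_smul]
    rw [smul_sub, ← sub_eq_zero] at h1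
    rw [← sub_eq_zero, ← h1]
    abel

end Relations

/-! ### Change of the index type -/

section Transport

variable {ι κ A : Type*} [LinearOrder ι] [LinearOrder κ] [Ring A] [Algebra ℂ A]

theorem sort_map_orderEmb (e : ι ↪o κ) (s : Finset ι) :
    (s.map e.toEmbedding).sort = s.sort.map e := by
  induction s using Finset.induction_on_min with
  | empty => simp
  | insert m s hm ih =>
    have hms : m ∉ s := fun hh => lt_irrefl _ (hm m hh)
    rw [map_insert, sort_insert, sort_insert _ (fun j hj => (hm j hj).le) hms, ih]
    · rfl
    · intro j hj
      obtain ⟨k, hk, rfl⟩ := mem_map.mp hj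
      exact e.le_iff_le.mpr (hm k hk).le
    · simpa using hms

theorem wprod_map (e : ι ↪o κ) (w : κ → κ → ℂ) (t : κ → A) (s : Finset ι) :
    wprod w t (s.map e.toEmbedding) = wprod (fun i j => w (e i) (e j)) (t ∘ e) s := by
  rw [wprod, wprod, sort_map_orderEmb, List.map_map]
  congr 1
  simp only [prod_filter, prod_map]
  simp

theorem prod₂_map {ι κ ι' κ' : Type*} (φ : ℂ → ℂ → ℂ) (x : ι' → ℂ) (y : κ' → ℂ) (e : ι ↪ ι')
    (e' : κ ↪ κ') (s : Finset ι) (t : Finset κ) :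
    prod₂ φ x (s.map e) y (t.map e') = prod₂ φ (x ∘ e) s (y ∘ e') t := by
  simp [prod₂, prod_map]

theorem orderEmbOfFin_map {n : ℕ} (e : ι ↪o κ) (s : Finset ι) (hs : #s = n)
    (hs' : #(s.map e.toEmbedding) = n) (i : Fin n) :
    (s.map e.toEmbedding).orderEmbOfFin hs' i = e (s.orderEmbOfFin hs i) := by
  have := orderEmbOfFin_unique hs' (f := e ∘ s.orderEmbOfFin hs)
    (fun i => mem_map_of_mem _ (orderEmbOfFin_mem _ _ _))
    (e.strictMono.comp (s.orderEmbOfFin hs).strictMono)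
  exact (congrFun this i).symm

theorem dwpfOn_map {ι' κ' : Type*} [LinearOrder ι'] [LinearOrder κ'] (c : ℂ) (x : ι' → ℂ)
    (y : κ' → ℂ) (e : ι ↪o ι') (e' : κ ↪o κ') (s : Finset ι) (t : Finset κ) :
    dwpfOn c x y (s.map e.toEmbedding) (t.map e'.toEmbedding)
      = dwpfOn c (x ∘ e) (y ∘ e') s t := by
  by_cases hcard : #s = #t
  · rw [dwpfOn_eq c x y ((card_map _).trans hcard) (card_map _), dwpfOn_eq c _ _ hcard rfl]
    simp only [orderEmbOfFin_map e s hcard, orderEmbOfFin_map e' t rfl, Function.comp_apply]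
  · rw [dwpfOn_of_card_ne _ _ _ (by simpa using hcard), dwpfOn_of_card_ne _ _ _ hcard]

theorem gOn_map {ι κ ι' κ' : Type*} (c : ℂ) (x : ι' → ℂ)
    (y : κ' → ℂ) (e : ι ↪ ι') (e' : κ ↪ κ') (s : Finset ι) (t : Finset κ) :
    gOn c x y (s.map e) (t.map e') = gOn c (x ∘ e) (y ∘ e') s t := by
  simp only [gOn, card_map, prod₂_map]

theorem sum_powerset_map_univ {ι κ M : Type*} [AddCommMonoid M] [Fintype ι] (e : ι ↪ κ)
    (F : Finset κ → M) :
    ∑ α ∈ (univ.map e).powerset, F α = ∑ α : Finset ι, F (α.map e) := by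
  symm
  refine sum_bij (fun α _ => α.map e) ?_ ?_ ?_ ?_
  · intro α _
    exact mem_powerset.mpr (map_subset_map.mpr (subset_univ α))
  · intro α _ β _ hαβ
    exact map_injective e hαβ
  · intro α hα
    obtain ⟨β, _, rfl⟩ := subset_map_iff.mp (mem_powerset.mp hα)
    exact ⟨β, mem_univ _, rfl⟩
  · intros; rfl

theorem map_univ_sdiff_map [Fintype ι] (e : ι ↪ κ) (s : Finset ι) :
    univ.map e \ s.map e = sᶜ.map e := by
  rw [compl_eq_univ_sdiff, Finset.map_sdiff]

end Transport

/-! ### The operators X and Y as sums over pairs of subsets -/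

section Operators

variable {ι A : Type*} [LinearOrder ι] [Ring A] [Algebra ℂ A]

theorem ordProd_eq_wprod (F : ℂ → A) (x : ι → ℂ) (s : Finset ι) :
    ordProd F x s = wprod 1 (F ∘ x) s := by
  rw [ordProd, wprod]
  simp [Function.comp_def]

theorem colT_eq_divH (c : ℂ) (T : Fin 3 → Fin 3 → ℂ → A) (j : Fin 3) (x : ι → ℂ) (s : Finset ι) :
    colT c T j x s = divH c x (T j 2 ∘ x) s := by
  rw [colT, divH, wprod]
  simp only [prod_inv_distrib]
  rfl

theorem prod_prod_eq_lt_mul_gt (φ : ι → ι → ℂ) (hφ : ∀ i, φ i i = 1) (s : Finset ι) :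
    ∏ l ∈ s, ∏ m ∈ s, φ l m
      = (∏ l ∈ s, ∏ m ∈ s with m < l, φ l m) * ∏ l ∈ s, ∏ m ∈ s with m < l, φ m l := by
  simp only [prod_filter]
  rw [prod_comm (s := s) (t := s) (f := fun l m => if m < l then φ m l else 1), ← prod_mul_distrib]
  refine prod_congr rfl fun l _ => ?_
  rw [← prod_mul_distrib]
  refine prod_congr rfl fun m _ => ?_
  rcases lt_trichotomy l m with hlm | rfl | hlm
  · simp [hlm, hlm.not_gt]
  · simp [hφ]
  · simp [hlm, hlm.not_gt]

/-- In h(ū_α, ū_α) the diagonal factors are 1, one of the two triangles cancels the denominators of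
𝕋, and the other is the weight of `mulH`. -/
theorem prod₂_h_smul_colT {c : ℂ} (hc : c ≠ 0) (T : Fin 3 → Fin 3 → ℂ → A) (j : Fin 3) (x : ι → ℂ)
    (s : Finset ι) (hs : ∀ i ∈ s, ∀ k ∈ s, h c (x i) (x k) ≠ 0) :
    prod₂ (h c) x s x s • colT c T j x s = mulH c x (T j 2 ∘ x) s := by
  rw [prod₂, prod_prod_eq_lt_mul_gt (fun l m => h c (x l) (x m)) (fun i => h_self hc _), colT,
    smul_smul, mul_right_comm, mul_inv_cancel₀, one_mul]
  · rfl
  · exact prod_ne_zero_iff.mpr fun l hl => prod_ne_zero_iff.mpr fun m hm =>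
      hs l hl m (mem_filter.mp hm).1

theorem sum_sub_eq_sum_finset {M : Type*} [AddCommMonoid M] {a b : ℕ}
    (F : Finset (Fin a) → Finset (Fin b) → M) :
    ∑ n ∈ range (min a b + 1), ∑ α : Sub a n, ∑ β : Sub b n, F α.1 β.1
      = ∑ α : Finset (Fin a), ∑ β : Finset (Fin b), if #β = #α then F α β else 0 := by
  have e : ∀ {m : ℕ} (n : ℕ) (G : Finset (Fin m) → M),
      ∑ α : Sub m n, G α.1 = ∑ α : Finset (Fin m), if n = #α then G α else 0 := by
    intro m n G
    rw [← sum_filter]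
    exact (sum_subtype (p := fun s : Finset (Fin m) => #s = n) _
      (fun s => by simp [eq_comm]) G).symm
  have e2 : ∀ n, ∑ α : Sub a n, ∑ β : Sub b n, F α.1 β.1 = ∑ α : Finset (Fin a),
      if n = #α then ∑ β : Finset (Fin b), if n = #β then F α β else 0 else 0 := fun n => by
    rw [← e n fun α => ∑ β : Finset (Fin b), if n = #β then F α β else 0]
    exact sum_congr rfl fun α _ => e n (F α.1)
  rw [sum_congr rfl fun n _ => e2 n, sum_comm]
  refine sum_congr rfl fun α _ => ?_
  rw [sum_ite_eq']
  split_ifs with hα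
  · exact sum_congr rfl fun β _ => by simp only [eq_comm]
  · rw [sum_eq_zero]
    intro β _
    have h1 := card_le_univ α
    have h2 := card_le_univ β
    rw [Fintype.card_fin] at h1 h2
    rw [mem_range] at hα
    exact if_neg (by omega)

variable {c : ℂ} {T : Fin 3 → Fin 3 → ℂ → A} {a b : ℕ}

theorem opX_eq_sum (hc : c ≠ 0) (T : Fin 3 → Fin 3 → ℂ → A) (u : Fin a → ℂ) (v : Fin b → ℂ)
    (huu : ∀ i j, h c (u i) (u j) ≠ 0) :
    opX c T u v = ∑ α : Finset (Fin a), ∑ β : Finset (Fin b),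
      (gOn c v u β α * prod₂ (f c) u α u αᶜ * prod₂ (g c) v βᶜ v β) •
        (mulH c u (T 0 2 ∘ u) α * wprod 1 (T 0 1 ∘ u) αᶜ * divH c v (T 1 2 ∘ v) βᶜ *
          wprod 1 (T 1 1 ∘ v) β) := by
  have := sum_sub_eq_sum_finset fun (α : Finset (Fin a)) (β : Finset (Fin b)) =>
    (prod₂ (g c) v β u α * prod₂ (f c) u α u αᶜ * prod₂ (g c) v βᶜ v β *
      prod₂ (h c) u α u α) •
    (colT c T 0 u α * ordProd (T 0 1) u αᶜ * colT c T 1 v βᶜ * ordProd (T 1 1) v β)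
  refine this.trans (sum_congr rfl fun α _ => sum_congr rfl fun β _ => ?_)
  rw [gOn]
  split_ifs
  · rw [mul_smul, ← smul_mul_assoc (prod₂ (h c) u α u α), ← smul_mul_assoc (prod₂ (h c) u α u α),
      ← smul_mul_assoc (prod₂ (h c) u α u α),
      prod₂_h_smul_colT hc T 0 u α fun i _ k _ => huu i k]
    simp only [ordProd_eq_wprod, colT_eq_divH]
  · simp

theorem opY_eq_sum (c : ℂ) (T : Fin 3 → Fin 3 → ℂ → A) (u : Fin a → ℂ) (v : Fin b → ℂ) :
    opY c T u v = ∑ α : Finset (Fin a), ∑ β : Finset (Fin b),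
      (dwpfOn c v u β α * prod₂ (f c) u α u αᶜ * prod₂ (g c) v βᶜ v β) •
        (divH c v (T 0 2 ∘ v) β * divH c v (T 1 2 ∘ v) βᶜ * wprod 1 (T 0 1 ∘ u) αᶜ *
          wprod 1 (T 1 1 ∘ u) α) := by
  have := sum_sub_eq_sum_finset fun (α : Finset (Fin a)) (β : Finset (Fin b)) =>
    (dwpfOn c v u β α * prod₂ (f c) u α u αᶜ * prod₂ (g c) v βᶜ v β) •
    (colT c T 0 v β * colT c T 1 v βᶜ * ordProd (T 0 1) u αᶜ * ordProd (T 1 1) u α)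
  have e : opY c T u v = _ := Eq.trans ?_ this
  · refine e.trans (sum_congr rfl fun α _ => sum_congr rfl fun β _ => ?_)
    split_ifs with hcard
    · simp only [ordProd_eq_wprod, colT_eq_divH]
    · rw [dwpfOn_of_card_ne _ _ _ hcard]
      simp
  · refine sum_congr rfl fun n _ => sum_congr rfl fun α _ => sum_congr rfl fun β _ => ?_
    rw [coeffY, dwpfOn_eq c v u β.2 α.2]
    rfl

theorem opX_eq_opY {D : Set ℂ} (hc : c ≠ 0) (hT : IsMonodromy c D T)
    {u : Fin a → ℂ} {v : Fin b → ℂ} (huD : ∀ i, u i ∈ D) (hvD : ∀ j, v j ∈ D)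
    (hu : Function.Injective u) (hv : Function.Injective v) (huv : ∀ i j, u i ≠ v j)
    (huu : ∀ i j, u i - u j + c ≠ 0) (hvv : ∀ i j, v i - v j + c ≠ 0)
    (hvu : ∀ i j, v j - u i + c ≠ 0) :
    opX c T u v = opY c T u v := by
  -- The lexicographic sum is a linear order into which both index sets embed monotonically, so
  -- ordered products and K are preserved.
  set x : Lex (Fin a ⊕ Fin b) → ℂ := fun i => Sum.elim u v (ofLex i) with hxdef
  let e₁ : Fin a ↪o Lex (Fin a ⊕ Fin b) :=
    OrderEmbedding.ofStrictMono (fun i => Sum.inlₗ i) Sum.Lex.inl_strictMono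
  let e₂ : Fin b ↪o Lex (Fin a ⊕ Fin b) :=
    OrderEmbedding.ofStrictMono (fun i => Sum.inrₗ i) Sum.Lex.inr_strictMono
  have hx1 : x ∘ e₁ = u := rfl
  have hx2 : x ∘ e₂ = v := rfl
  have hx : Function.Injective x :=
    (Function.Injective.sumElim hu hv huv).comp ofLex.injective
  have hxD : ∀ i, x i ∈ D := by
    intro i
    change Sum.elim u v (ofLex i) ∈ D
    rcases ofLex i with i | i
    · exact huD i
    · exact hvD i
  have hE := hT.isExchangeFamily hc hx hxD
  have key := sumX_eq_sumY hE hc hx (U := univ.map e₁.toEmbedding) (V := univ.map e₂.toEmbedding)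
    ?_ ?_ ?_
  · rw [opX_eq_sum hc T u v fun i j => h_ne_zero hc (huu i j), opY_eq_sum c T u v]
    simp only [sumX, sumY, sum_powerset_map_univ, map_univ_sdiff_map, prod₂_map, gOn_map,
      dwpfOn_map, mulH, divH, wprod_map] at key
    exact key
  · rw [disjoint_left]
    intro i hi hi'
    obtain ⟨j, _, rfl⟩ := mem_map.mp hi
    obtain ⟨k, _, hk⟩ := mem_map.mp hi'
    exact huv j k (congrArg x hk).symm
  · intro i hi j hj
    obtain ⟨i, _, rfl⟩ := mem_map.mp hi
    obtain ⟨j, _, rfl⟩ := mem_map.mp hj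
    exact h_ne_zero hc (hvv i j)
  · intro i hi j hj
    obtain ⟨i, _, rfl⟩ := mem_map.mp hi
    obtain ⟨j, _, rfl⟩ := mem_map.mp hj
    exact h_ne_zero hc (hvu j i)

end Operators

/-! ### The antimorphism as a twist of the monodromy matrix -/

section Twist

variable {A : Type*} [Ring A] [Algebra ℂ A]

/-- The sign of `ψ` on `T_{ij}`, times `-i` if `T_{ij}` is odd. -/
def twistCoeff (i j : Fin 3) : ℂ :=
  (-1) ^ (par i * par j + par i) * (-Complex.I) ^ ((par i + par j) % 2)

/-- The image of the monodromy matrix under `ψ`, rescaled so that its entries satisfy the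
original relations in the opposite algebra. -/
def twist (T : Fin 3 → Fin 3 → ℂ → A) (i j : Fin 3) (u : ℂ) : Aᵐᵒᵖ :=
  MulOpposite.op (twistCoeff i j • T j i u)

/-- The sign condition under which the relation for the transposed indices becomes the original one
in the opposite algebra; a check of 81 cases. -/
theorem twistCoeff_mul (i j k l : Fin 3) :
    twistCoeff i j * twistCoeff k l * ((-1) ^ ((par i + par j) * (par k + par l)) *
        (-1) ^ (par j * (par l + par k) + par l * par k))
      = (-1) ^ (par i * (par k + par l) + par k * par l) * (twistCoeff k j * twistCoeff i l) := by
  fin_cases i <;> fin_cases j <;> fin_cases k <;> fin_cases l <;>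
    norm_num [twistCoeff, par]

/-- Transposing all indices and reversing products preserves the shape of the relations up to signs.
The factor −i on odd entries contributes (−i)² = −1 for two odd factors, as the grading demands. -/
theorem IsMonodromy.twist {c : ℂ} {D : Set ℂ} {T : Fin 3 → Fin 3 → ℂ → A}
    (hT : IsMonodromy c D T) : IsMonodromy c D (twist T) := by
  intro i j k l u hu v hv huv
  have h1 := hT j i l k u hu v hv huv
  apply MulOpposite.unop_injective
  simp only [SuperYangian.twist, MulOpposite.unop_sub, MulOpposite.unop_smul, MulOpposite.unop_mul,
    MulOpposite.unop_op, smul_mul_smul_comm]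
  set s : ℂ := (-1) ^ ((par i + par j) * (par k + par l)) with hs
  have hss : s * s = 1 := by
    rw [hs, ← mul_pow]; simp
  have hs' : (-1 : ℂ) ^ ((par j + par i) * (par l + par k)) = s := by
    rw [hs, add_comm (par j), add_comm (par l)]
  rw [hs'] at h1
  -- Multiplication by −s, with s² = 1, reverses the roles of the two products in the graded
  -- commutator.
  have h2 : T l k v * T j i u - s • (T j i u * T l k v)
      = -s • (T j i u * T l k v - s • (T l k v * T j i u)) := by
    rw [smul_sub, smul_smul, neg_mul, hss, neg_smul, neg_smul, one_smul]
    abel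
  have h3 := twistCoeff_mul i j k l
  rw [mul_comm (twistCoeff k l), smul_comm s, ← smul_sub, h2, h1, mul_comm (twistCoeff i l),
    ← smul_sub, smul_smul, smul_smul, smul_smul, ← neg_sub (T l i u * T j k v), smul_neg,
    ← neg_smul]
  congr 1
  linear_combination g c u v * h3

end Twist

/-! ### Evaluation of ψ through the twist -/

section Words

theorem basisFreeMonoid_eq (w : FreeMonoid Gen) :
    FreeAlgebra.basisFreeMonoid ℂ Gen w = (w.toList.map (FreeAlgebra.ι ℂ)).prod := by
  simp [FreeAlgebra.basisFreeMonoid, FreeAlgebra.equivMonoidAlgebraFreeMonoid,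
    FreeMonoid.lift_apply]

theorem psi_word (w : List Gen) : psi ((w.map (FreeAlgebra.ι ℂ)).prod) = psiWord w := by
  have := basisFreeMonoid_eq (FreeMonoid.ofList w)
  rw [FreeMonoid.toList_ofList] at this
  rw [← this, psi, Module.Basis.constr_basis, FreeMonoid.toList_ofList]

/-- The span of the words of total parity weight `p`. -/
def wordSpan (p : ℕ) : Submodule ℂ (FreeAlgebra ℂ Gen) :=
  Submodule.span ℂ {y | ∃ w : List Gen, wordPar w = p ∧ (w.map (FreeAlgebra.ι ℂ)).prod = y}

theorem mul_mem_wordSpan {p q : ℕ} {y z : FreeAlgebra ℂ Gen} (hy : y ∈ wordSpan p)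
    (hz : z ∈ wordSpan q) : y * z ∈ wordSpan (p + q) := by
  have h1 := Submodule.mul_mem_mul hy hz
  rw [wordSpan, wordSpan, Submodule.span_mul_span] at h1
  refine Submodule.span_mono ?_ h1
  rintro _ ⟨_, ⟨w, rfl, rfl⟩, _, ⟨w', rfl, rfl⟩, rfl⟩
  exact ⟨w ++ w', by simp [wordPar], by simp⟩

theorem one_mem_wordSpan : (1 : FreeAlgebra ℂ Gen) ∈ wordSpan 0 :=
  Submodule.subset_span ⟨[], rfl, rfl⟩

theorem genT_mem_wordSpan (i j : Fin 3) (u : ℂ) : genT i j u ∈ wordSpan (par i + par j) :=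
  Submodule.subset_span ⟨[(i, j, u)], by simp [wordPar], by simp [genT]⟩

theorem ordProd_genT_mem_wordSpan {ι : Type*} [LinearOrder ι] (i j : Fin 3) (x : ι → ℂ)
    (s : Finset ι) : ordProd (genT i j) x s ∈ wordSpan (#s * (par i + par j)) := by
  rw [ordProd, ← length_sort (s := s) (· ≤ ·)]
  induction s.sort with
  | nil => simpa using one_mem_wordSpan
  | cons k l ih =>
    rw [List.map_cons, List.prod_cons, List.length_cons, add_mul, one_mul, add_comm]
    exact mul_mem_wordSpan (genT_mem_wordSpan i j _) ih

theorem colT_genT_mem_wordSpan {ι : Type*} [LinearOrder ι] (c : ℂ) {j : Fin 3} (hj : par j = 0)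
    (x : ι → ℂ) (s : Finset ι) : colT c genT j x s ∈ wordSpan #s := by
  have := ordProd_genT_mem_wordSpan j 2 x s
  rw [hj, show par 2 = 1 from rfl, zero_add, mul_one] at this
  exact Submodule.smul_mem _ _ this

/-- Homogeneity makes the correction between ψ and the twist one scalar for all of X. The odd
letters number #α + #βᶜ, which is b because #α = #β. -/
theorem opX_genT_mem_wordSpan (c : ℂ) {a b : ℕ} (u : Fin a → ℂ) (v : Fin b → ℂ) :
    opX c genT u v ∈ wordSpan b := by
  refine Submodule.sum_mem _ fun n _ => Submodule.sum_mem _ fun α _ =>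
    Submodule.sum_mem _ fun β _ => Submodule.smul_mem _ _ ?_
  have h1 := mul_mem_wordSpan (mul_mem_wordSpan (mul_mem_wordSpan
    (colT_genT_mem_wordSpan c (j := 0) rfl u α.1) (ordProd_genT_mem_wordSpan 0 1 u α.1ᶜ))
    (colT_genT_mem_wordSpan c (j := 1) rfl v β.1ᶜ)) (ordProd_genT_mem_wordSpan 1 1 v β.1)
  have h2 : #α.1 + #α.1ᶜ * (par 0 + par 1) + #β.1ᶜ + #β.1 * (par 1 + par 1) = b := by
    have h3 := card_add_card_compl β.1
    rw [Fintype.card_fin] at h3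
    have h4 : #α.1 = #β.1 := α.2.trans β.2.symm
    simp only [par, Matrix.cons_val_zero, Matrix.cons_val_one, add_zero, mul_zero]
    omega
  rwa [h2] at h1

variable {H : Type*} [AddCommGroup H] [Module ℂ H]

/-- For n odd letters, graded reversal gives the sign (−1)^(n(n−1)/2), while the twist gives (−i)^n.
Their ratio depends only on the parity of n and equals I^(n mod 2). -/
theorem evalT_psiWord (T : Fin 3 → Fin 3 → ℂ → Module.End ℂ H) (w : List Gen) :
    evalT T (psiWord w) = Complex.I ^ (wordPar w % 2) • MulOpposite.unop
      (FreeAlgebra.lift ℂ (fun x : Gen => twist T x.1 x.2.1 x.2.2)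
        (w.map (FreeAlgebra.ι ℂ)).prod) := by
  induction w with
  | nil => simp [psiWord, wordPar]
  | cons y w ih =>
    obtain ⟨i, j, u⟩ := y
    have hw : wordPar ((i, j, u) :: w) = (par i + par j) + wordPar w := by simp [wordPar]
    rw [psiWord, map_smul, map_mul, ih, map_smul, List.map_cons, List.prod_cons, map_mul, hw,
      MulOpposite.unop_mul, FreeAlgebra.lift_ι_apply]
    simp only [genT, evalT, FreeAlgebra.lift_ι_apply, twist, MulOpposite.unop_op,
      smul_mul_assoc, mul_smul_comm, smul_smul]
    congr 1
    rw [twistCoeff]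
    rcases Nat.even_or_odd (par i + par j) with hp | hp <;>
      rcases Nat.even_or_odd (wordPar w) with hq | hq
    · simp [hp.add hq, Nat.even_iff.mp, hp.mul_right, hp, hq]
    · simp [hp.add_odd hq, Nat.even_iff.mp, Nat.odd_iff.mp, hp.mul_right, hp, hq, mul_comm]
    · simp [hp.add_even hq, Nat.even_iff.mp, Nat.odd_iff.mp, hq.mul_left, hp, hq,
        mul_left_comm Complex.I]
    · simp [hp.add_odd hq, Nat.even_iff.mp, Nat.odd_iff.mp, hp.mul hq, hp, hq]

theorem evalT_psi (T : Fin 3 → Fin 3 → ℂ → Module.End ℂ H) {p : ℕ} {y : FreeAlgebra ℂ Gen}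
    (hy : y ∈ wordSpan p) :
    evalT T (psi y) = Complex.I ^ (p % 2) • MulOpposite.unop
      (FreeAlgebra.lift ℂ (fun x : Gen => twist T x.1 x.2.1 x.2.2) y) := by
  induction hy using Submodule.span_induction with
  | mem y hy =>
    obtain ⟨w, rfl, rfl⟩ := hy
    rw [psi_word, evalT_psiWord]
  | zero => simp
  | add y z _ _ hy hz => simp only [map_add, hy, hz, MulOpposite.unop_add, smul_add]
  | smul r y _ hy => rw [map_smul, map_smul, hy, map_smul, MulOpposite.unop_smul, smul_comm]

theorem map_opX {A B : Type*} [Ring A] [Algebra ℂ A] [Ring B] [Algebra ℂ B] (φ : A →ₐ[ℂ] B)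
    (c : ℂ) (T : Fin 3 → Fin 3 → ℂ → A) {a b : ℕ} (u : Fin a → ℂ) (v : Fin b → ℂ) :
    φ (opX c T u v) = opX c (fun i j z => φ (T i j z)) u v := by
  simp only [opX, partX, colT, ordProd, map_sum, map_smul, map_mul, map_list_prod, List.map_map,
    Function.comp_def]

theorem evalT_psi_opX (T : Fin 3 → Fin 3 → ℂ → Module.End ℂ H) (c : ℂ) {a b : ℕ} (u : Fin a → ℂ)
    (v : Fin b → ℂ) :
    evalT T (psi (opX c genT u v))
      = Complex.I ^ (b % 2) • MulOpposite.unop (opX c (twist T) u v) := by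
  rw [evalT_psi T (opX_genT_mem_wordSpan c u v), map_opX]
  simp only [genT, FreeAlgebra.lift_ι_apply]

theorem I_pow_mul_neg_I_pow (b : ℕ) :
    Complex.I ^ (b % 2) * (-Complex.I) ^ b = (-1) ^ (b * (b - 1) / 2) := by
  rw [← Nat.choose_two_right]
  induction b using Nat.twoStepInduction with
  | zero => simp
  | one => simp
  | more b ih _ =>
    have h1 : (b + 2).choose 2 = b.choose 2 + 2 * b + 1 := by
      rw [Nat.choose_succ_succ' (b + 1) 1, Nat.choose_succ_succ' b 1, Nat.choose_one_right,
        Nat.choose_one_right]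
      ring
    rw [h1, Nat.add_mod_right, pow_add, ← mul_assoc, ih, pow_succ (-1 : ℂ), pow_add, pow_mul]
    simp

end Words

/-! ### Symmetric products in the opposite algebra -/

section OppositeProducts

variable {ι A : Type*} [LinearOrder ι] [Ring A] [Algebra ℂ A]

/-- Passing to the opposite algebra reverses the factors; by symmetry of the weighted product they
can be put back in increasing order, at the price of transposed weights. -/
theorem unop_wprod {w w' : ι → ι → ℂ} {r : ι → A} {s : Finset ι} (hww' : ∀ i j, w' i j = w j i)
    (hw : ∀ i ∈ s, ∀ j ∈ s, i ≠ j → w i j • (r i * r j) = w j i • (r j * r i)) :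
    MulOpposite.unop (wprod w' (fun i => MulOpposite.op (r i)) s) = wprod w r s := by
  induction s using Finset.induction_on_min with
  | empty => simp
  | insert m s hm ih =>
    have hms : m ∉ s := fun hh => lt_irrefl _ (hm m hh)
    rw [wprod_insert_min _ _ hm, wprod_insert_right hms hw, MulOpposite.unop_smul,
      MulOpposite.unop_mul, ih, MulOpposite.unop_op]
    · simp only [hww']
    · exact fun i hi j hj => hw i (mem_insert_of_mem hi) j (mem_insert_of_mem hj)

theorem wprod_smul (w : ι → ι → ℂ) (k : ℂ) (r : ι → A) (s : Finset ι) :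
    wprod w (fun i => k • r i) s = k ^ #s • wprod w r s := by
  induction s using Finset.induction_on_min with
  | empty => simp
  | insert m s hm ih =>
    have hms : m ∉ s := fun hh => lt_irrefl _ (hm m hh)
    rw [wprod_insert_min _ _ hm, wprod_insert_min _ _ hm, ih, card_insert_of_notMem hms,
      smul_mul_smul_comm, smul_comm, pow_succ']

theorem rowT_eq_wprod (c : ℂ) (T : Fin 3 → Fin 3 → ℂ → A) (k : Fin 3) (x : ι → ℂ) (s : Finset ι) :
    rowT c T k x s = wprod (fun i j => (h c (x i) (x j))⁻¹) (T 2 k ∘ x) s := by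
  rw [rowT, wprod]
  simp only [prod_inv_distrib]
  rfl

variable {c : ℂ} {D : Set ℂ} {T : Fin 3 → Fin 3 → ℂ → A}

theorem unop_ordProd_twist (hT : IsMonodromy c D T) {i j : Fin 3} (hi : par i = 0)
    (hj : par j = 0) {x : ι → ℂ} (hx : ∀ k, x k ∈ D) (s : Finset ι) :
    MulOpposite.unop (ordProd (twist T i j) x s) = ordProd (T j i) x s := by
  have h1 : twist T i j ∘ x = fun k => MulOpposite.op ((T j i ∘ x) k) := by
    ext k
    simp [twist, twistCoeff, hi, hj]
  rw [ordProd_eq_wprod, ordProd_eq_wprod, h1]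
  refine unop_wprod (fun _ _ => rfl) fun k _ l _ _ => ?_
  simp [hT.commute_even hj hi (hx k) (hx l)]

theorem unop_colT_twist (hT : IsMonodromy c D T) (hc : c ≠ 0) {j : Fin 3} (hj : par j = 0)
    {x : ι → ℂ} (hx : ∀ k, x k ∈ D) (hinj : Function.Injective x)
    (hh : ∀ k l, h c (x k) (x l) ≠ 0) (s : Finset ι) :
    MulOpposite.unop (colT c (twist T) j x s) = (-Complex.I) ^ #s • rowT c T j x s := by
  have h1 : twist T j 2 ∘ x = fun k => -Complex.I • MulOpposite.op ((T 2 j ∘ x) k) := by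
    ext k
    simp [twist, twistCoeff, hj, show par 2 = 1 from rfl]
  rw [colT_eq_divH, divH, rowT_eq_wprod, h1, wprod_smul, MulOpposite.unop_smul]
  congr 1
  refine unop_wprod (fun _ _ => rfl) fun k _ l _ hkl => ?_
  have := hT.row_symm hc hj (hx k) (hx l) (hinj.ne hkl)
  rw [inv_smul_eq_iff₀ (hh k l), smul_comm, eq_inv_smul_iff₀ (hh l k)]
  exact this

end OppositeProducts

/-! ### Action on the vacuum and its dual -/

section Vacuum

variable {H : Type*} [AddCommGroup H] [Module ℂ H] {D : Set ℂ}
  {T : Fin 3 → Fin 3 → ℂ → Module.End ℂ H} {lam : Fin 3 → ℂ → ℂ}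

theorem dual_comp_sum {κ : Type*} (Ω' : Module.Dual ℂ H) (s : Finset κ) (F : κ → Module.End ℂ H) :
    Ω' ∘ₗ ∑ k ∈ s, F k = ∑ k ∈ s, Ω' ∘ₗ F k := by
  ext
  simp [LinearMap.sum_apply]

theorem IsVacuum.ordProd_apply {Ω : H} (hΩ : IsVacuum D T lam Ω) {ι : Type*} [LinearOrder ι]
    (i : Fin 3) {x : ι → ℂ} (hx : ∀ k, x k ∈ D) (s : Finset ι) :
    ordProd (T i i) x s Ω = (∏ k ∈ s, lam i (x k)) • Ω := by
  rw [ordProd_eq_wprod]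
  induction s using Finset.induction_on_min with
  | empty => simp
  | insert m s hm ih =>
    have hms : m ∉ s := fun hh => lt_irrefl _ (hm m hh)
    rw [wprod_insert_min _ _ hm, prod_insert hms]
    simp only [Pi.one_apply, prod_const_one, one_smul, Module.End.mul_apply, ih, map_smul,
      Function.comp_apply, hΩ.1 i _ (hx m), smul_smul]
    rw [mul_comm]

theorem IsDualVacuum.comp_ordProd {Ω' : Module.Dual ℂ H} (hΩ : IsDualVacuum D T lam Ω')
    {ι : Type*} [LinearOrder ι] (i : Fin 3) {x : ι → ℂ} (hx : ∀ k, x k ∈ D) (s : Finset ι) :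
    Ω' ∘ₗ ordProd (T i i) x s = (∏ k ∈ s, lam i (x k)) • Ω' := by
  rw [ordProd_eq_wprod]
  induction s using Finset.induction_on_min with
  | empty =>
    ext
    simp
  | insert m s hm ih =>
    have hms : m ∉ s := fun hh => lt_irrefl _ (hm m hh)
    rw [wprod_insert_min _ _ hm, prod_insert hms]
    simp only [Pi.one_apply, prod_const_one, one_smul, Module.End.mul_eq_comp,
      ← LinearMap.comp_assoc, Function.comp_apply, hΩ.1 i _ (hx m), LinearMap.smul_comp, ih,
      smul_smul]

end Vacuum

/-! ### The terms with n = 0 -/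

section LowestTerms

variable {A : Type*} [Ring A] [Algebra ℂ A]

theorem sum_sub_zero {M : Type*} [AddCommMonoid M] {a : ℕ} (F : Sub a 0 → M) :
    ∑ α, F α = F ⟨∅, card_empty⟩ := by
  have : ∀ α : Sub a 0, α = ⟨∅, card_empty⟩ := fun α => Subtype.ext (card_eq_zero.mp α.2)
  rw [Fintype.sum_eq_single ⟨∅, card_empty⟩ fun α hα => absurd (this α) hα]

theorem partX_zero (c : ℂ) (T : Fin 3 → Fin 3 → ℂ → A) {a b : ℕ} (u : Fin a → ℂ) (v : Fin b → ℂ) :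
    partX c T u v 0 = ordProd (T 0 1) u univ * colT c T 1 v univ := by
  rw [partX, sum_sub_zero, sum_sub_zero]
  simp [coeffX, prod₂, colT, ordProd]

theorem partY_zero (c : ℂ) (T : Fin 3 → Fin 3 → ℂ → A) {a b : ℕ} (u : Fin a → ℂ) (v : Fin b → ℂ) :
    partY c T u v 0 = colT c T 1 v univ * ordProd (T 0 1) u univ := by
  rw [partY, sum_sub_zero, sum_sub_zero]
  simp [coeffY, dwpf, prod₂, colT, ordProd]

theorem sum_range_eq_zero_add_sum_Icc {M : Type*} [AddCommMonoid M] (F : ℕ → M) (m : ℕ) :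
    ∑ n ∈ range (m + 1), F n = F 0 + ∑ n ∈ Icc 1 m, F n := by
  rw [range_eq_Ico, sum_eq_sum_Ico_succ_bot (Nat.succ_pos m)]
  rfl

end LowestTerms

end

end SuperYangian

/-! ### The theorem -/

open SuperYangian in
theorem mainTheorem2 {H : Type*} [AddCommGroup H] [Module ℂ H]
    (c : ℂ) (hc : c ≠ 0) (D : Set ℂ) (T : Fin 3 → Fin 3 → ℂ → Module.End ℂ H)
    (hT : IsMonodromy c D T)
    (a b : ℕ) (u : Fin a → ℂ) (v : Fin b → ℂ)
    (huD : ∀ i, u i ∈ D) (hvD : ∀ j, v j ∈ D)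
    (hu : Function.Injective u) (hv : Function.Injective v) (huv : ∀ i j, u i ≠ v j)
    (huu : ∀ i j, u i - u j + c ≠ 0) (hvv : ∀ i j, v i - v j + c ≠ 0)
    (hvu : ∀ i j, v j - u i + c ≠ 0) :
    opX c T u v = opY c T u v ∧
    (ordProd (T 0 1) u Finset.univ * colT c T 1 v Finset.univ
        - colT c T 1 v Finset.univ * ordProd (T 0 1) u Finset.univ
      = ∑ n ∈ Finset.Icc 1 (min a b), (partY c T u v n - partX c T u v n)) ∧
    (∀ (lam : Fin 3 → ℂ → ℂ) (Ω : H), IsVacuum D T lam Ω →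
      bethe c T Ω u v = opY c T u v Ω ∧
      bethe c T Ω u v = ∑ n ∈ Finset.range (min a b + 1), ∑ α : Sub a n, ∑ β : Sub b n,
        (coeffX c u v α β * ∏ j ∈ β.1, lam 1 (v j)) •
          (colT c T 0 u α.1 * ordProd (T 0 1) u α.1ᶜ * colT c T 1 v β.1ᶜ) Ω ∧
      bethe c T Ω u v = ∑ n ∈ Finset.range (min a b + 1), ∑ α : Sub a n, ∑ β : Sub b n,
        (coeffY c u v α β * ∏ i ∈ α.1, lam 1 (u i)) •
          (colT c T 0 v β.1 * colT c T 1 v β.1ᶜ * ordProd (T 0 1) u α.1ᶜ) Ω) ∧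
    (∀ (lam : Fin 3 → ℂ → ℂ) (Ω' : Module.Dual ℂ H), IsDualVacuum D T lam Ω' →
      dualBethe c T Ω' u v = (-1 : ℂ) ^ (b * (b - 1) / 2) •
        ∑ n ∈ Finset.range (min a b + 1), ∑ α : Sub a n, ∑ β : Sub b n,
          (coeffX c u v α β * ∏ j ∈ β.1, lam 1 (v j)) •
            (Ω' ∘ₗ (rowT c T 1 v β.1ᶜ * ordProd (T 1 0) u α.1ᶜ * rowT c T 0 u α.1)) ∧
      dualBethe c T Ω' u v = (-1 : ℂ) ^ (b * (b - 1) / 2) •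
        ∑ n ∈ Finset.range (min a b + 1), ∑ α : Sub a n, ∑ β : Sub b n,
          (coeffY c u v α β * ∏ i ∈ α.1, lam 1 (u i)) •
            (Ω' ∘ₗ (ordProd (T 1 0) u α.1ᶜ * rowT c T 1 v β.1ᶜ * rowT c T 0 v β.1))) := by
  have hXY := opX_eq_opY hc hT huD hvD hu hv huv huu hvv hvu
  refine ⟨hXY, ?_, ?_, ?_⟩
  · have h1 := hXY
    rw [opX, opY, sum_range_eq_zero_add_sum_Icc, sum_range_eq_zero_add_sum_Icc, partX_zero,
      partY_zero] at h1
    rw [sum_sub_distrib, sub_eq_sub_iff_add_eq_add, h1, add_comm]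
  · intro lam Ω hΩ
    refine ⟨congrArg (fun y : Module.End ℂ H => y Ω) hXY, ?_, ?_⟩
    · simp only [bethe, opX, partX, LinearMap.sum_apply, LinearMap.smul_apply]
      refine sum_congr rfl fun n _ => sum_congr rfl fun α _ => sum_congr rfl fun β _ => ?_
      rw [Module.End.mul_apply, hΩ.ordProd_apply 1 hvD, map_smul, smul_smul]
    · rw [bethe, hXY]
      simp only [opY, partY, LinearMap.sum_apply, LinearMap.smul_apply]
      refine sum_congr rfl fun n _ => sum_congr rfl fun α _ => sum_congr rfl fun β _ => ?_
      rw [Module.End.mul_apply, hΩ.ordProd_apply 1 huD, map_smul, smul_smul]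
  · intro lam Ω' hΩ
    -- Each of the two row products contributes a power of −i: n from 𝕋₃₁ and b − n from 𝕋₃₂. The
    -- total does not depend on n, so it comes out of the sum.
    have hcard : ∀ {n : ℕ} (β : Sub b n), (-Complex.I) ^ b
        = (-Complex.I) ^ #β.1ᶜ * (-Complex.I) ^ n := by
      intro n β
      have h3 := card_add_card_compl β.1
      rw [Fintype.card_fin, β.2] at h3
      rw [← pow_add, add_comm, h3]
    have hu' : ∀ k l, h c (u k) (u l) ≠ 0 := fun k l => h_ne_zero hc (huu k l)
    have hv' : ∀ k l, h c (v k) (v l) ≠ 0 := fun k l => h_ne_zero hc (hvv k l)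
    constructor
    · rw [dualBethe, evalT_psi_opX, ← I_pow_mul_neg_I_pow, mul_smul, LinearMap.comp_smul]
      congr 1
      simp only [opX, partX, Finset.unop_sum, dual_comp_sum, smul_sum]
      refine sum_congr rfl fun n _ => sum_congr rfl fun α _ => sum_congr rfl fun β _ => ?_
      rw [MulOpposite.unop_smul, MulOpposite.unop_mul, MulOpposite.unop_mul, MulOpposite.unop_mul,
        unop_ordProd_twist hT rfl rfl hvD, unop_ordProd_twist hT rfl rfl huD,
        unop_colT_twist hT hc rfl huD hu hu', unop_colT_twist hT hc rfl hvD hv hv',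
        Module.End.mul_eq_comp (ordProd (T 1 1) v β.1), LinearMap.comp_smul,
        ← LinearMap.comp_assoc, hΩ.comp_ordProd 1 hvD, hcard β, α.2]
      simp only [smul_mul_assoc, mul_smul_comm, LinearMap.smul_comp, LinearMap.comp_smul,
        smul_smul, mul_assoc]
      congr 1
      ring
    -- The second form comes from X = Y for the twisted monodromy matrix in the opposite algebra.
    · rw [dualBethe, evalT_psi_opX, ← I_pow_mul_neg_I_pow, mul_smul, LinearMap.comp_smul,
        opX_eq_opY hc hT.twist huD hvD hu hv huv huu hvv hvu]
      congr 1
      simp only [opY, partY, Finset.unop_sum, dual_comp_sum, smul_sum]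
      refine sum_congr rfl fun n _ => sum_congr rfl fun α _ => sum_congr rfl fun β _ => ?_
      rw [MulOpposite.unop_smul, MulOpposite.unop_mul, MulOpposite.unop_mul, MulOpposite.unop_mul,
        unop_ordProd_twist hT rfl rfl huD, unop_ordProd_twist hT rfl rfl huD,
        unop_colT_twist hT hc rfl hvD hv hv', unop_colT_twist hT hc rfl hvD hv hv',
        Module.End.mul_eq_comp (ordProd (T 1 1) u α.1), LinearMap.comp_smul,
        ← LinearMap.comp_assoc, hΩ.comp_ordProd 1 huD, hcard β, β.2]
      simp only [smul_mul_assoc, mul_smul_comm, LinearMap.smul_comp, LinearMap.comp_smul,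
        smul_smul, mul_assoc]
      congr 1
      ring
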